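/- Let $M$ be a smooth manifold of dimension $D$ with a smooth pseudo-Riemannian metric $g$ (of any signature) and Levi-Civita connection $\nabla$, and let $T$ be a smooth 3-form on $M$. Let $\nabla^T_X Y=\nabla_X Y+\tfrac12\sum_a T(X,Y,X_a)X^a$, where $(X_a)$ is a local frame and $(X^a)$ the reciprocal frame, $g(X^a,X_b)=\delta^a_b$; with $(e^a)$ the coframe dual to $(X_a)$, the induced connection on forms gives $d^T\Psi=\sum_a e^a\wedge\nabla^T_{X_a}\Psi$ and $\delta^T\Psi=-\sum_a X^a\lrcorner\nabla^T_{X_a}\Psi$. A smooth $p$-form $k$ is a generalized conformal Killing–Yano (GCKY) $p$-form for $(g,T)$ if for every vector field $X$ $$\nabla^T_X k-\frac1{p+1}\,X\lrcorner d^Tk+\frac1{D-p+1}\,X^\flat\wedge\delta^Tk=0 .$$ Let $k$ be a GCKY $p$-form for $(g,T)$. Then: (4) for every smooth nowhere vanishing function $\Omega:M\to\mathbb R$, $\Omega^{p+1}k$ is a GCKY $p$-form for the metric $\Omega^2g$ and the torsion 3-form $\Omega^2T$; (5) if $\xi$ is a smooth vector field and $f:M\to\mathbb R$ a function such that $L_\xi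 g=2fg$ and $L_\xi T=2fT$, then $L_\xi k-(p+1)f\,k$ is a GCKY $p$-form for $(g,T)$. -/

import Mathlib

open scoped Manifold ContDiff

noncomputable section

namespace KillingYano

/-- The model space `ℝ^D`. -/
abbrev Model (D : ℕ) : Type := EuclideanSpace ℝ (Fin D)

/-! ## Tensor calculus in a coordinate patch of `ℝ^D`

`G` is the matrix of components of a metric, `T` a 3-form, `K` a `p`-form and `V` a vector field,
all in coordinates. `∂_a` is the coordinate basis. -/

section Coordinates

variable {D p : ℕ}

/-- The coordinate basis vector `X_a = ∂_a`. -/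
def basisVec (a : Fin D) : Model D := EuclideanSpace.single a 1

/-- The reciprocal basis vector `X^a = g^{ab} ∂_b`, that is the vector with
`g(X^a, w) = w^a` for all `w`. -/
def dualVec (G : Model D → Model D →L[ℝ] Model D →L[ℝ] ℝ) (y : Model D) (a : Fin D) : Model D :=
  (G y).inverse (EuclideanSpace.proj a)

/-- The Christoffel symbols of the Levi-Civita connection,
`Γ(u, v) = ½ (∂_u g(v, X_a) + ∂_v g(u, X_a) - ∂_a g(u, v)) X^a`. -/
def christoffel (G : Model D → Model D →L[ℝ] Model D →L[ℝ] ℝ) (y u v : Model D) : Model D :=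
  ∑ a : Fin D, ((1 / 2 : ℝ) * (fderiv ℝ G y u v (basisVec a) + fderiv ℝ G y v u (basisVec a)
    - fderiv ℝ G y (basisVec a) u v)) • dualVec G y a

/-- The connection coefficients of `∇^T`, where `∇^T_u v = ∇_u v + ½ T(u, v, X_a) X^a`. -/
def connT (G : Model D → Model D →L[ℝ] Model D →L[ℝ] ℝ)
    (T : Model D → Model D [⋀^Fin 3]→L[ℝ] ℝ) (y u v : Model D) : Model D :=
  christoffel G y u v + (1 / 2 : ℝ) • ∑ a : Fin D, T y ![u, v, basisVec a] • dualVec G y a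

/-- The covariant derivative `(∇^T_u K)(w_1, …, w_p)` induced by `∇^T` on `p`-forms. -/
def covT (G : Model D → Model D →L[ℝ] Model D →L[ℝ] ℝ)
    (T : Model D → Model D [⋀^Fin 3]→L[ℝ] ℝ) (K : Model D → Model D [⋀^Fin p]→L[ℝ] ℝ)
    (y u : Model D) (w : Fin p → Model D) : ℝ :=
  fderiv ℝ K y u w - ∑ i : Fin p, K y (Function.update w i (connT G T y u (w i)))

/-- The `(p+1)`-form `d^T K = e^a ∧ ∇^T_{X_a} K`. -/
def extT (G : Model D → Model D →L[ℝ] Model D →L[ℝ] ℝ)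
    (T : Model D → Model D [⋀^Fin 3]→L[ℝ] ℝ) (K : Model D → Model D [⋀^Fin p]→L[ℝ] ℝ)
    (y : Model D) (w : Fin (p + 1) → Model D) : ℝ :=
  ∑ i : Fin (p + 1), (-1 : ℝ) ^ (i : ℕ) * covT G T K y (w i) (i.removeNth w)

/-- The `q`-form `δ^T K = -X^a ⌟ ∇^T_{X_a} K`, for a `(q+1)`-form `K`. -/
def codiffT {q : ℕ} (G : Model D → Model D →L[ℝ] Model D →L[ℝ] ℝ)
    (T : Model D → Model D [⋀^Fin 3]→L[ℝ] ℝ) (K : Model D → Model D [⋀^Fin (q + 1)]→L[ℝ] ℝ)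
    (y : Model D) (w : Fin q → Model D) : ℝ :=
  -∑ a : Fin D, covT G T K y (basisVec a) (Fin.cons (dualVec G y a) w)

/-- The `p`-form `v^♭ ∧ δ^T K`; it is zero for `p = 0`, as `δ^T` annihilates functions. -/
def flatWedgeCodiffT (G : Model D → Model D →L[ℝ] Model D →L[ℝ] ℝ)
    (T : Model D → Model D [⋀^Fin 3]→L[ℝ] ℝ) :
    {p : ℕ} → (Model D → Model D [⋀^Fin p]→L[ℝ] ℝ) → (y v : Model D) → (Fin p → Model D) → ℝ
  | 0, _, _, _, _ => 0
  | q + 1, K, y, v, w =>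
    ∑ i : Fin (q + 1), (-1 : ℝ) ^ (i : ℕ) * G y v (w i) * codiffT G T K y (i.removeNth w)

/-- The left hand side of the generalized conformal Killing–Yano equation,
`∇^T_v K - 1/(p+1) v ⌟ d^T K + 1/(D-p+1) v^♭ ∧ δ^T K`, evaluated on `w_1, …, w_p`. -/
def gckyOp (G : Model D → Model D →L[ℝ] Model D →L[ℝ] ℝ)
    (T : Model D → Model D [⋀^Fin 3]→L[ℝ] ℝ) (K : Model D → Model D [⋀^Fin p]→L[ℝ] ℝ)
    (y v : Model D) (w : Fin p → Model D) : ℝ :=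
  covT G T K y v w - 1 / ((p : ℝ) + 1) * extT G T K y (Fin.cons v w)
    + 1 / ((D : ℝ) - p + 1) * flatWedgeCodiffT G T K y v w

/-- The Lie derivative of a `p`-form along a vector field,
`(L_V K)(w) = (∂_V K)(w) + ∑ i, K(w_1, …, ∂_{w_i} V, …, w_p)`; the second term is written as the
derivative at the identity, in direction `DV`, of `A ↦ A^* K`. -/
def lieForm (V : Model D → Model D) (K : Model D → Model D [⋀^Fin p]→L[ℝ] ℝ) (y : Model D) :
    Model D [⋀^Fin p]→L[ℝ] ℝ :=
  fderiv ℝ K y (V y) +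
    (K y).fderivCompContinuousLinearMap (ContinuousLinearMap.id ℝ (Model D)) (fderiv ℝ V y)

theorem lieForm_apply (V : Model D → Model D) (K : Model D → Model D [⋀^Fin p]→L[ℝ] ℝ)
    (y : Model D) (w : Fin p → Model D) :
    lieForm V K y w = fderiv ℝ K y (V y) w +
      ∑ i : Fin p, K y (Function.update w i (fderiv ℝ V y (w i))) := by
  have h : ∀ i : Fin p, (fun j => Function.update
      (fun _ : Fin p => ContinuousLinearMap.id ℝ (Model D)) i (fderiv ℝ V y) j (w j)) =
      Function.update w i (fderiv ℝ V y (w i)) := by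
    intro i
    funext j
    rcases eq_or_ne j i with rfl | hj
    · simp
    · simp [hj]
  simp [lieForm, h]

/-- The Lie derivative of a metric along a vector field,
`(L_V G)(u, w) = ∂_V G (u, w) + G(∂_u V, w) + G(u, ∂_w V)`. -/
def lieBilin (V : Model D → Model D) (G : Model D → Model D →L[ℝ] Model D →L[ℝ] ℝ) (y : Model D) :
    Model D →L[ℝ] Model D →L[ℝ] ℝ :=
  fderiv ℝ G y (V y) +
    (G y).bilinearComp (fderiv ℝ V y) (ContinuousLinearMap.id ℝ (Model D)) +
    (G y).bilinearComp (ContinuousLinearMap.id ℝ (Model D)) (fderiv ℝ V y)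

end Coordinates

/-! ## Tensor fields on a manifold -/

section Manifold

variable (D : ℕ) (M : Type*) [TopologicalSpace M] [ChartedSpace (Model D) M]

/-- A (not necessarily smooth) vector field. -/
abbrev VecField : Type _ := ∀ x : M, TangentSpace (𝓡 D) x

/-- A (not necessarily smooth) field of bilinear forms on the tangent spaces. -/
abbrev BilinField : Type _ :=
  ∀ x : M, TangentSpace (𝓡 D) x →L[ℝ] TangentSpace (𝓡 D) x →L[ℝ] ℝ

/-- A (not necessarily smooth) differential `p`-form. -/
abbrev FormField (p : ℕ) : Type _ := ∀ x : M, TangentSpace (𝓡 D) x [⋀^Fin p]→L[ℝ] ℝ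

variable {D M} {p : ℕ}

/-- The coordinate expression of a vector field in the chart `e`. -/
def localVec (e : OpenPartialHomeomorph M (Model D)) (ξ : VecField D M) : Model D → Model D :=
  VectorField.mpullback (𝓡 D) (𝓡 D) e.symm ξ

/-- The coordinate expression of a field of bilinear forms in the chart `e`, that is its pullback
under `e⁻¹`. -/
def localBilin (e : OpenPartialHomeomorph M (Model D)) (g : BilinField D M) (y : Model D) :
    Model D →L[ℝ] Model D →L[ℝ] ℝ :=
  (ContinuousLinearMap.precomp ℝ (mfderiv (𝓡 D) (𝓡 D) e.symm y)) ∘L (g (e.symm y)) ∘L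
    (mfderiv (𝓡 D) (𝓡 D) e.symm y)

theorem localBilin_apply (e : OpenPartialHomeomorph M (Model D)) (g : BilinField D M)
    (y u v : Model D) :
    localBilin e g y u v = g (e.symm y) (mfderiv (𝓡 D) (𝓡 D) e.symm y u)
      (mfderiv (𝓡 D) (𝓡 D) e.symm y v) := rfl

/-- The coordinate expression of a form in the chart `e`, that is its pullback under `e⁻¹`. -/
def localForm (e : OpenPartialHomeomorph M (Model D)) (k : FormField D M p) (y : Model D) :
    Model D [⋀^Fin p]→L[ℝ] ℝ :=
  (k (e.symm y)).compContinuousLinearMap (mfderiv (𝓡 D) (𝓡 D) e.symm y)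

/-- Smoothness of a `p`-form: its components in every chart are smooth. -/
def IsSmoothForm (k : FormField D M p) : Prop :=
  ∀ e ∈ atlas (Model D) M, ContDiffOn ℝ ∞ (localForm e k) e.target

/-- A smooth pseudo-Riemannian metric, of arbitrary signature. -/
structure IsPseudoRiemannianMetric (g : BilinField D M) : Prop where
  smooth : ∀ e ∈ atlas (Model D) M, ContDiffOn ℝ ∞ (localBilin e g) e.target
  symm : ∀ (x : M) (u v : TangentSpace (𝓡 D) x), g x u v = g x v u
  nondegenerate : ∀ (x : M) (u : TangentSpace (𝓡 D) x), (∀ v, g x u v = 0) → u = 0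

/-- `k` is a smooth solution of the generalized conformal Killing–Yano equation for the metric `g`
and the torsion 3-form `T`: the (tensorial) equation holds in every chart, at every point. -/
structure IsGCKY (g : BilinField D M) (T : FormField D M 3) (k : FormField D M p) : Prop where
  smooth : IsSmoothForm k
  equation : ∀ e ∈ atlas (Model D) M, ∀ y ∈ e.target, ∀ (v : Model D) (w : Fin p → Model D),
    gckyOp (localBilin e g) (localForm e T) (localForm e k) y v w = 0

/-- The Lie derivative `L_ξ k` of a `p`-form, computed at each point `x` in the preferred chart
at `x` (the result does not depend on the chart). -/
def lieDerivForm (ξ : VecField D M) (k : FormField D M p) : FormField D M p := fun x =>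
  (lieForm (localVec (chartAt (Model D) x) ξ) (localForm (chartAt (Model D) x) k)
    (chartAt (Model D) x x)).compContinuousLinearMap
      (mfderiv (𝓡 D) (𝓡 D) (chartAt (Model D) x) x)

/-- The Lie derivative `L_ξ g` of a field of bilinear forms, computed at each point `x` in the
preferred chart at `x` (the result does not depend on the chart). -/
def lieDerivBilin (ξ : VecField D M) (g : BilinField D M) : BilinField D M := fun x =>
  (ContinuousLinearMap.precomp ℝ (mfderiv (𝓡 D) (𝓡 D) (chartAt (Model D) x) x)) ∘L
    (lieBilin (localVec (chartAt (Model D) x) ξ) (localBilin (chartAt (Model D) x) g)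
      (chartAt (Model D) x x)) ∘L
    (mfderiv (𝓡 D) (𝓡 D) (chartAt (Model D) x) x)

theorem lieDerivBilin_apply (ξ : VecField D M) (g : BilinField D M) (x : M)
    (u v : TangentSpace (𝓡 D) x) :
    lieDerivBilin ξ g x u v =
      lieBilin (localVec (chartAt (Model D) x) ξ) (localBilin (chartAt (Model D) x) g)
        (chartAt (Model D) x x) (mfderiv (𝓡 D) (𝓡 D) (chartAt (Model D) x) x u)
        (mfderiv (𝓡 D) (𝓡 D) (chartAt (Model D) x) x v) := rfl

/-- Smoothness of a vector field, as a section of the tangent bundle. -/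
def IsSmoothVec [IsManifold (𝓡 D) ∞ M] (ξ : VecField D M) : Prop :=
  ContMDiff (𝓡 D) (𝓡 D).tangent ∞ (fun x => (⟨x, ξ x⟩ : TangentBundle (𝓡 D) M))

end Manifold

end KillingYano

end

open KillingYano

/-! The equation is equivalent to a statement about shape. For `p = q + 1` it says that `∇^T_u k = u
⌟ α + u^♭ ∧ β` for some forms `α`, `β`, with no reference to `d^T` or `δ^T`. Antisymmetrizing kills
the second term, because `g` is symmetric, and returns `(q + 2) α`. Contracting with the inverse
metric kills the first and returns `(D - q) β`. So `α` and `β` are forced to be the multiples of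
`d^T k` and `δ^T k` in the equation (`gckyOp_eq_zero_of_isConformalKilling`,
`cov_eq_of_gckyOp_eq_zero`). For `p = 0` every function is a solution.

Both claims then rest on one endomorphism, `confDiff`: `v ↦ θ(u) v + θ(v) u - g(u, v) θ^♯`. On a
`p`-form it acts by `(p + 1) θ(u) k - u ⌟ (θ ∧ k) - u^♭ ∧ (θ^♯ ⌟ k)` (`act_confDiff`). The last two
terms have the permitted shape; only the first must be compensated.

Rescaling: passing to `(Ω² g, Ω² T)` changes the connection by `confDiff` with `θ = Ω⁻¹ dΩ`, since
the torsion term is unaffected (`conn_conformal`). The derivative of the weight `Ω^(p+1)` cancels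
the bad term.

Conformal symmetry: `∇^T L_ξ k` differs from `L_ξ ∇^T k` by the action of the Lie derivative of the
connection (`cov_lieForm`), which is `confDiff` with `θ = df` (`lieConn_eq_confDiff`). The Lie
derivative preserves the shape of `∇^T k`, and subtracting `(p + 1) f k` removes the bad term. All
this is done in charts; naturality of Lie derivatives under transition maps links it to the global
definitions. -/

noncomputable section

namespace KillingYano

/-! ### Multilinear algebra: derivations, exterior and interior products. -/

section Algebra

variable {E : Type*} [NormedAddCommGroup E] [NormedSpace ℝ E] {p q : ℕ}

/-- The derivation of the algebra of forms induced by endomorphisms of the vector space: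
`(act K A)(w) = ∑ i, K(w_1, …, A w_i, …, w_p)`. -/
def act : (E [⋀^Fin p]→L[ℝ] ℝ) →L[ℝ] (E →L[ℝ] E) →L[ℝ] (E [⋀^Fin p]→L[ℝ] ℝ) :=
  ContinuousAlternatingMap.fderivCompContinuousLinearMapCLM ℝ (ContinuousLinearMap.id ℝ E)

theorem act_eq (K : E [⋀^Fin p]→L[ℝ] ℝ) (A : E →L[ℝ] E) :
    act K A = K.fderivCompContinuousLinearMap (ContinuousLinearMap.id ℝ E) A := rfl

theorem act_apply (K : E [⋀^Fin p]→L[ℝ] ℝ) (A : E →L[ℝ] E) (w : Fin p → E) :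
    act K A w = ∑ i, K (Function.update w i (A (w i))) := by
  rw [act_eq, ContinuousAlternatingMap.fderivCompContinuousLinearMap_apply]
  refine Finset.sum_congr rfl fun i _ => ?_
  congr 1
  funext j
  rcases eq_or_ne j i with rfl | hj
  · simp
  · simp [hj]

theorem act_id (K : E [⋀^Fin p]→L[ℝ] ℝ) :
    act K (ContinuousLinearMap.id ℝ E) = (p : ℝ) • K := by
  ext w
  simp [act_apply]

/-- Terms in which `A` and `B` hit different slots are symmetric in the pair and cancel; those
hitting the same slot leave the commutator, in reversed order because forms are pulled back. -/
theorem act_act_sub (K : E [⋀^Fin p]→L[ℝ] ℝ) (A B : E →L[ℝ] E) :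
    act (act K A) B - act (act K B) A = act K (A ∘L B - B ∘L A) := by
  have expand : ∀ (A B : E →L[ℝ] E) (w : Fin p → E), act (act K A) B w =
      ∑ i, ∑ j ∈ Finset.univ.erase i,
        K (Function.update (Function.update w i (B (w i))) j (A (w j))) +
      ∑ i, K (Function.update w i (A (B (w i)))) := by
    intro A B w
    simp only [act_apply]
    rw [← Finset.sum_add_distrib]
    refine Finset.sum_congr rfl fun i _ => ?_
    rw [← Finset.sum_erase_add _ _ (Finset.mem_univ i)]
    congr 1
    · refine Finset.sum_congr rfl fun j hj => ?_
      rw [Function.update_of_ne (Finset.ne_of_mem_erase hj)]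
    · simp
  have swap : ∀ w : Fin p → E,
      ∑ i, ∑ j ∈ Finset.univ.erase i,
        K (Function.update (Function.update w i (B (w i))) j (A (w j))) =
      ∑ i, ∑ j ∈ Finset.univ.erase i,
        K (Function.update (Function.update w i (A (w i))) j (B (w j))) := by
    intro w
    rw [Finset.sum_comm' (t' := Finset.univ) (s' := fun j => Finset.univ.erase j)
      (by intro x y; simp [eq_comm])]
    refine Finset.sum_congr rfl fun i _ => Finset.sum_congr rfl fun j hj => ?_
    rw [Function.update_comm (Finset.ne_of_mem_erase hj)]
  ext w
  rw [map_sub]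
  simp only [ContinuousAlternatingMap.sub_apply]
  rw [expand, expand, swap]
  simp [act_apply]

/-- The exterior product `θ ∧ β` of a covector and a form. -/
def wedge : (E →L[ℝ] ℝ) →L[ℝ] (E [⋀^Fin q]→L[ℝ] ℝ) →L[ℝ] (E [⋀^Fin (q + 1)]→L[ℝ] ℝ) :=
  (ContinuousLinearMap.compL ℝ (E [⋀^Fin q]→L[ℝ] ℝ) (E →L[ℝ] E [⋀^Fin q]→L[ℝ] ℝ)
      (E [⋀^Fin (q + 1)]→L[ℝ] ℝ) (ContinuousAlternatingMap.alternatizeUncurryFinCLM ℝ E ℝ)) ∘L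
    ContinuousLinearMap.smulRightL ℝ E (E [⋀^Fin q]→L[ℝ] ℝ)

theorem wedge_eq (θ : E →L[ℝ] ℝ) (β : E [⋀^Fin q]→L[ℝ] ℝ) :
    wedge θ β = ContinuousAlternatingMap.alternatizeUncurryFin (θ.smulRight β) := rfl

theorem wedge_apply (θ : E →L[ℝ] ℝ) (β : E [⋀^Fin q]→L[ℝ] ℝ) (w : Fin (q + 1) → E) :
    wedge θ β w = ∑ i : Fin (q + 1), (-1 : ℝ) ^ (i : ℕ) * (θ (w i) * β (i.removeNth w)) := by
  simp [wedge_eq, ContinuousAlternatingMap.alternatizeUncurryFin_apply]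

theorem removeNth_succ_cons {X : Type*} {n : ℕ} (u : X) (w : Fin (n + 1) → X)
    (i : Fin (n + 1)) :
    i.succ.removeNth (Fin.cons u w : Fin (n + 2) → X) = Fin.cons u (i.removeNth w) := by
  funext j
  refine Fin.cases ?_ (fun j => ?_) j <;> simp [Fin.removeNth]

theorem curryLeft_wedge (θ : E →L[ℝ] ℝ) (β : E [⋀^Fin (q + 1)]→L[ℝ] ℝ) (u : E) :
    (wedge θ β).curryLeft u = θ u • β - wedge θ (β.curryLeft u) := by
  ext w
  simp only [ContinuousAlternatingMap.curryLeft_apply_apply, wedge_apply,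
    ContinuousAlternatingMap.sub_apply, ContinuousAlternatingMap.smul_apply, smul_eq_mul]
  rw [Fin.sum_univ_succ, sub_eq_add_neg, ← Finset.sum_neg_distrib]
  congr 1
  · simp
  · refine Finset.sum_congr rfl fun i _ => ?_
    have h : i.succ.removeNth (Matrix.vecCons u w) = Matrix.vecCons u (i.removeNth w) :=
      removeNth_succ_cons u w i
    rw [h]
    simp [pow_succ]

/-- Rank-one endomorphisms turn the derivation into `θ ∧ (x ⌟ K)`; this computes both the action of
`confDiff` and the trace in `sum_curryLeft_wedge`. -/
theorem act_smulRight (K : E [⋀^Fin (q + 1)]→L[ℝ] ℝ) (θ : E →L[ℝ] ℝ) (x : E) :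
    act K (θ.smulRight x) = wedge θ (K.curryLeft x) := by
  rw [act_eq, ContinuousAlternatingMap.fderivCompContinuousLinearMap_eq_alternatizeUncurryFin]
  ext w
  simp [wedge_eq, ContinuousAlternatingMap.alternatizeUncurryFin_apply]

theorem curryLeft_act (α : E [⋀^Fin (q + 1)]→L[ℝ] ℝ) (A : E →L[ℝ] E) (u : E) :
    (act α A).curryLeft u = α.curryLeft (A u) + act (α.curryLeft u) A := by
  ext w
  simp only [ContinuousAlternatingMap.curryLeft_apply_apply, act_apply,
    ContinuousAlternatingMap.add_apply]
  rw [Fin.sum_univ_succ]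
  congr 1
  · congr 1
    exact Fin.update_cons_zero (α := fun _ => E) u w (A u)
  · refine Finset.sum_congr rfl fun i _ => ?_
    congr 1
    exact (Fin.cons_update (α := fun _ => E) u w i (A (w i))).symm

theorem act_wedge (θ : E →L[ℝ] ℝ) (β : E [⋀^Fin q]→L[ℝ] ℝ) (A : E →L[ℝ] E) :
    act (wedge θ β) A = wedge (θ ∘L A) β + wedge θ (act β A) := by
  ext w
  simp only [act_apply, wedge_apply, ContinuousAlternatingMap.add_apply]
  rw [Finset.sum_comm, ← Finset.sum_add_distrib]
  refine Finset.sum_congr rfl fun i _ => ?_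
  rw [Fin.sum_univ_succAbove _ i]
  have h : ∀ j : Fin q, i.removeNth (Function.update w (i.succAbove j) (A (w (i.succAbove j)))) =
      Function.update (i.removeNth w) j (A (i.removeNth w j)) := by
    intro j
    exact Fin.removeNth_update_succAbove i j _ _
  simp only [h, Function.update_self, Fin.removeNth_update]
  simp only [Function.update_of_ne (Fin.succAbove_ne i _).symm, ContinuousLinearMap.comp_apply,
    Finset.mul_sum]

/-- In a frame this is `e^a ∧ X_a^♭ ∧ β`, which vanishes since `B` is symmetric. -/
theorem alternatizeUncurryFin_wedge {B : E →L[ℝ] E →L[ℝ] ℝ} (hB : ∀ u v, B u v = B v u)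
    (β : E [⋀^Fin q]→L[ℝ] ℝ) :
    ContinuousAlternatingMap.alternatizeUncurryFin ((wedge.flip β) ∘L B) = 0 := by
  have := ContinuousAlternatingMap.alternatizeUncurryFin_alternatizeUncurryFinCLM_comp_of_symmetric
    (f := ((ContinuousLinearMap.smulRightL ℝ E (E [⋀^Fin q]→L[ℝ] ℝ)).flip β) ∘L B)
    (by intro x y; simp [hB x y])
  exact this

/-- A `q+1`-form valued covector `A` has the shape of the covariant derivative of a conformal
Killing-Yano form: `A u = u ⌟ α + u^♭ ∧ β`. -/
def IsConformalKilling (B : E →L[ℝ] E →L[ℝ] ℝ) (A : E →L[ℝ] E [⋀^Fin (q + 1)]→L[ℝ] ℝ) : Prop :=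
  ∃ (α : E [⋀^Fin (q + 2)]→L[ℝ] ℝ) (β : E [⋀^Fin q]→L[ℝ] ℝ),
    ∀ u, A u = α.curryLeft u + wedge (B u) β

end Algebra

/-! ### Contractions with a nondegenerate metric. -/

section Metric

variable {D : ℕ}

theorem sum_smul_basisVec (w : Model D) : ∑ a, w a • basisVec a = w := by
  ext b
  simp [basisVec, Pi.single_apply]

theorem isInvertible_of_nondegenerate {B : Model D →L[ℝ] Model D →L[ℝ] ℝ}
    (hn : ∀ u, (∀ v, B u v = 0) → u = 0) : B.IsInvertible := by
  have hinj : Function.Injective B.toLinearMap := by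
    rw [← LinearMap.ker_eq_bot, LinearMap.ker_eq_bot']
    intro u hu
    refine hn u fun v => ?_
    have : B u = 0 := hu
    simp [this]
  have hrank : Module.finrank ℝ (Model D) = Module.finrank ℝ (Model D →L[ℝ] ℝ) := by
    rw [← (LinearMap.toContinuousLinearMap (𝕜 := ℝ) (E := Model D) (F' := ℝ)).finrank_eq]
    exact (Subspace.dual_finrank_eq).symm
  refine ⟨(LinearEquiv.ofInjectiveOfFinrankEq B.toLinearMap hinj hrank).toContinuousLinearEquiv, ?_⟩
  ext u v
  rfl

variable {G : Model D → Model D →L[ℝ] Model D →L[ℝ] ℝ} {y : Model D}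

theorem metric_dualVec (hn : ∀ u, (∀ v, G y u v = 0) → u = 0) (a : Fin D) (w : Model D) :
    G y (dualVec G y a) w = w a := by
  rw [dualVec, (isInvertible_of_nondegenerate hn).self_apply_inverse]
  rfl

theorem metric_ext (hn : ∀ u, (∀ v, G y u v = 0) → u = 0) {u v : Model D}
    (h : ∀ w, G y u w = G y v w) : u = v :=
  sub_eq_zero.1 (hn _ fun w => by simp [h])

theorem sum_metric_smul_dualVec (hs : ∀ u v, G y u v = G y v u)
    (hn : ∀ u, (∀ v, G y u v = 0) → u = 0) (w : Model D) :
    ∑ a, G y (basisVec a) w • dualVec G y a = w := by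
  refine metric_ext hn fun v => ?_
  have : G y w v = G y (∑ a, v a • basisVec a) w := by rw [sum_smul_basisVec, hs]
  rw [this]
  simp [metric_dualVec hn, mul_comm]

theorem dualVec_eq_sum (hs : ∀ u v, G y u v = G y v u)
    (hn : ∀ u, (∀ v, G y u v = 0) → u = 0) (a : Fin D) :
    dualVec G y a = ∑ b, G y (dualVec G y a) (dualVec G y b) • basisVec b := by
  conv_lhs => rw [← sum_smul_basisVec (dualVec G y a)]
  refine Finset.sum_congr rfl fun b _ => ?_
  rw [hs, metric_dualVec hn]

theorem sum_curryLeft_dualVec {q : ℕ} (hs : ∀ u v, G y u v = G y v u)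
    (hn : ∀ u, (∀ v, G y u v = 0) → u = 0) (α : Model D [⋀^Fin (q + 2)]→L[ℝ] ℝ) :
    ∑ a, (α.curryLeft (basisVec a)).curryLeft (dualVec G y a) = 0 := by
  have anti : ∀ u v, (α.curryLeft u).curryLeft v = -(α.curryLeft v).curryLeft u := by
    intro u v
    have h := α.curryLeft_same (u + v)
    simp only [map_add, ContinuousAlternatingMap.curryLeft_add, add_apply,
      ContinuousAlternatingMap.curryLeft_same, zero_add, add_zero] at h
    rw [eq_neg_iff_add_eq_zero, add_comm]
    exact h
  have h : ∑ a, (α.curryLeft (basisVec a)).curryLeft (dualVec G y a) =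
      ∑ a, ∑ b, G y (dualVec G y a) (dualVec G y b) •
        (α.curryLeft (basisVec a)).curryLeft (basisVec b) := by
    refine Finset.sum_congr rfl fun a _ => ?_
    conv_lhs => rw [dualVec_eq_sum hs hn a]
    simp only [map_sum, map_smul]
  -- Exchanging the summation indices pairs the symmetric inverse metric with an antisymmetric
  -- double contraction, so the sum is its own negative.
  have h' : ∑ a, ∑ b, G y (dualVec G y a) (dualVec G y b) •
        (α.curryLeft (basisVec a)).curryLeft (basisVec b) =
      -∑ a, ∑ b, G y (dualVec G y a) (dualVec G y b) •
        (α.curryLeft (basisVec a)).curryLeft (basisVec b) := by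
    conv_lhs => rw [Finset.sum_comm]
    simp only [← Finset.sum_neg_distrib]
    refine Finset.sum_congr rfl fun a _ => Finset.sum_congr rfl fun b _ => ?_
    rw [hs, anti, smul_neg]
  rw [h]
  have h2 := eq_neg_iff_add_eq_zero.1 h'
  rw [← two_smul ℝ] at h2
  exact (smul_eq_zero.1 h2).resolve_left two_ne_zero

theorem metric_basisVec_dualVec (hs : ∀ u v, G y u v = G y v u)
    (hn : ∀ u, (∀ v, G y u v = 0) → u = 0) (a : Fin D) :
    G y (basisVec a) (dualVec G y a) = 1 := by
  rw [hs, metric_dualVec hn]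
  simp [basisVec]

/-- The antiderivation rule gives `g(X_a, X^a) β - X_a^♭ ∧ (X^a ⌟ β)`. The first term sums to `D β`;
the second is the action of the identity, hence `q β`. Degree zero is separate, as there `X^a ⌟ β`
has no meaning. -/
theorem sum_curryLeft_wedge {q : ℕ} (hs : ∀ u v, G y u v = G y v u)
    (hn : ∀ u, (∀ v, G y u v = 0) → u = 0) (β : Model D [⋀^Fin q]→L[ℝ] ℝ) :
    ∑ a, (wedge (G y (basisVec a)) β).curryLeft (dualVec G y a) = ((D : ℝ) - q) • β := by
  cases q with
  | zero =>
    ext w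
    have h : ∀ u, (0 : Fin 1).removeNth (Matrix.vecCons u w) = w := fun _ =>
      Subsingleton.elim _ _
    simp [ContinuousAlternatingMap.sum_apply, wedge_apply, metric_basisVec_dualVec hs hn, h]
  | succ q =>
    have h : ∑ a, (G y (basisVec a)).smulRight (dualVec G y a) =
        ContinuousLinearMap.id ℝ (Model D) := by
      ext1 w
      simp [sum_apply, sum_metric_smul_dualVec hs hn]
    simp only [curryLeft_wedge, metric_basisVec_dualVec hs hn, ← act_smulRight,
      Finset.sum_sub_distrib, ← map_sum, h, act_id]
    simp [← Nat.cast_smul_eq_nsmul ℝ]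
    module

theorem form_eq_zero_of_finrank_lt {E : Type*} [NormedAddCommGroup E] [NormedSpace ℝ E] {q : ℕ}
    [FiniteDimensional ℝ E] (h : Module.finrank ℝ E < q) (K : E [⋀^Fin q]→L[ℝ] ℝ) : K = 0 := by
  ext w
  refine K.toAlternatingMap.map_linearDependent w fun hw => ?_
  have := hw.fintype_card_le_finrank
  simp at this
  omega

end Metric

/-! ### The connection as a tensor, and the equation as a condition on the shape of `∇^T K`. -/

section Connection

variable {D p q : ℕ}
variable (G : Model D → Model D →L[ℝ] Model D →L[ℝ] ℝ) (T : Model D → Model D [⋀^Fin 3]→L[ℝ] ℝ)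

/-- The connection coefficients of `∇^T` with lowered index, `w ↦ g(Γ(u, v), w)`. -/
def connLow (y u v : Model D) : Model D →L[ℝ] ℝ :=
  (1 / 2 : ℝ) • (fderiv ℝ G y u v + fderiv ℝ G y v u - ((fderiv ℝ G y).flip u).flip v
    + (ContinuousAlternatingMap.apply ℝ (Model D) ℝ ![]) ∘L
      (((T y).curryLeft u).curryLeft v).curryLeft)

theorem connLow_apply (y u v w : Model D) : connLow G T y u v w =
    1 / 2 * (fderiv ℝ G y u v w + fderiv ℝ G y v u w - fderiv ℝ G y w u v + T y ![u, v, w]) := by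
  simp [connLow]
  ring

/-- Replacing the frame sum by the inverse metric makes bilinearity and smoothness of the connection
visible. -/
theorem connT_eq (y u v : Model D) : connT G T y u v = (G y).inverse (connLow G T y u v) := by
  have h : connLow G T y u v =
      ∑ a, connLow G T y u v (basisVec a) • (EuclideanSpace.proj a : Model D →L[ℝ] ℝ) := by
    ext w
    conv_lhs => rw [← sum_smul_basisVec w]
    simp [mul_comm]
  rw [h, map_sum, connT, christoffel, Finset.smul_sum, ← Finset.sum_add_distrib]
  refine Finset.sum_congr rfl fun a _ => ?_
  rw [map_smul, connLow_apply, smul_smul, ← add_smul, dualVec]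
  congr 1
  ring

variable {G} in
theorem metric_connT {y : Model D} (hn : ∀ u, (∀ v, G y u v = 0) → u = 0) (u v w : Model D) :
    G y (connT G T y u v) w =
      1 / 2 * (fderiv ℝ G y u v w + fderiv ℝ G y v u w - fderiv ℝ G y w u v + T y ![u, v, w]) := by
  rw [connT_eq, (isInvertible_of_nondegenerate hn).self_apply_inverse, connLow_apply]

/-- The connection coefficients of `∇^T` as a bilinear map. -/
def conn (y : Model D) : Model D →L[ℝ] Model D →L[ℝ] Model D :=
  LinearMap.toContinuousLinearMap
    (LinearMap.toContinuousLinearMap.toLinearMap ∘ₗ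
      LinearMap.mk₂ ℝ (connT G T y)
        (fun u u' v => by
          simp only [connT_eq, ← map_add]
          congr 1
          ext w
          simp [connLow]
          ring)
        (fun c u v => by
          simp only [connT_eq, ← map_smul]
          congr 1
          ext w
          simp [connLow]
          ring)
        (fun u v v' => by
          simp only [connT_eq, ← map_add]
          congr 1
          ext w
          simp [connLow]
          ring)
        (fun c u v => by
          simp only [connT_eq, ← map_smul]
          congr 1
          ext w
          simp [connLow]
          ring))

@[simp]
theorem conn_apply (y u v : Model D) : conn G T y u v = connT G T y u v := rfl

/-- The covariant derivative `∇^T K` as a form valued covector. -/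
def cov (K : Model D → Model D [⋀^Fin p]→L[ℝ] ℝ) (y : Model D) :
    Model D →L[ℝ] Model D [⋀^Fin p]→L[ℝ] ℝ :=
  fderiv ℝ K y - act (K y) ∘L conn G T y

theorem cov_apply (K : Model D → Model D [⋀^Fin p]→L[ℝ] ℝ) (y u : Model D) :
    cov G T K y u = fderiv ℝ K y u - act (K y) (conn G T y u) := rfl

theorem cov_apply_apply (K : Model D → Model D [⋀^Fin p]→L[ℝ] ℝ) (y u : Model D)
    (w : Fin p → Model D) : cov G T K y u w = covT G T K y u w := by
  simp [cov, covT, act_apply]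

/-- The form `-X^a ⌟ A X_a`. -/
def codiff (y : Model D) (A : Model D →L[ℝ] Model D [⋀^Fin (q + 1)]→L[ℝ] ℝ) :
    Model D [⋀^Fin q]→L[ℝ] ℝ :=
  -∑ a, (A (basisVec a)).curryLeft (dualVec G y a)

theorem extT_eq (K : Model D → Model D [⋀^Fin p]→L[ℝ] ℝ) (y : Model D)
    (w : Fin (p + 1) → Model D) :
    extT G T K y w = ContinuousAlternatingMap.alternatizeUncurryFin (cov G T K y) w := by
  simp [extT, ContinuousAlternatingMap.alternatizeUncurryFin_apply, cov_apply_apply]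

theorem codiffT_eq (K : Model D → Model D [⋀^Fin (q + 1)]→L[ℝ] ℝ) (y : Model D)
    (w : Fin q → Model D) : codiffT G T K y w = codiff G y (cov G T K y) w := by
  simp only [codiffT, codiff, ContinuousAlternatingMap.neg_apply,
    ContinuousAlternatingMap.sum_apply, ContinuousAlternatingMap.curryLeft_apply_apply,
    cov_apply_apply]
  rfl

theorem gckyOp_eq (K : Model D → Model D [⋀^Fin (q + 1)]→L[ℝ] ℝ) (y v : Model D)
    (w : Fin (q + 1) → Model D) :
    gckyOp G T K y v w = (cov G T K y v
      - (1 / ((q : ℝ) + 2)) •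
        (ContinuousAlternatingMap.alternatizeUncurryFin (cov G T K y)).curryLeft v
      + (1 / ((D : ℝ) - q)) • wedge (G y v) (codiff G y (cov G T K y))) w := by
  have h1 : ((q + 1 : ℕ) : ℝ) + 1 = (q : ℝ) + 2 := by push_cast; ring
  have h2 : (D : ℝ) - ((q + 1 : ℕ) : ℝ) + 1 = (D : ℝ) - q := by push_cast; ring
  rw [gckyOp, h1, h2]
  simp only [flatWedgeCodiffT, codiffT_eq, extT_eq, ← cov_apply_apply,
    ContinuousAlternatingMap.add_apply, ContinuousAlternatingMap.sub_apply,
    ContinuousAlternatingMap.smul_apply, wedge_apply, smul_eq_mul,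
    ContinuousAlternatingMap.curryLeft_apply_apply, mul_assoc]
  rfl

/-- On functions `v ⌟ d^T K` is `∇^T_v K` with coefficient `1`, and the codifferential term is
absent. -/
theorem gckyOp_zero (K : Model D → Model D [⋀^Fin 0]→L[ℝ] ℝ) (y v : Model D)
    (w : Fin 0 → Model D) : gckyOp G T K y v w = 0 := by
  have h : (0 : Fin 1).removeNth (Fin.cons v w : Fin 1 → Model D) = w := Subsingleton.elim _ _
  simp [gckyOp, flatWedgeCodiffT, extT, h]

variable {G}

theorem cov_eq_of_gckyOp_eq_zero {K : Model D → Model D [⋀^Fin (q + 1)]→L[ℝ] ℝ} {y : Model D}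
    (h : ∀ v w, gckyOp G T K y v w = 0) (u : Model D) :
    cov G T K y u = ((1 / ((q : ℝ) + 2)) •
        ContinuousAlternatingMap.alternatizeUncurryFin (cov G T K y)).curryLeft u
      + wedge (G y u) (-(1 / ((D : ℝ) - q)) • codiff G y (cov G T K y)) := by
  ext w
  have := h u w
  rw [gckyOp_eq] at this
  simp only [ContinuousAlternatingMap.add_apply, ContinuousAlternatingMap.sub_apply,
    ContinuousAlternatingMap.smul_apply, ContinuousAlternatingMap.curryLeft_smul, map_smul,
    smul_eq_mul, smul_apply] at this ⊢
  linarith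

theorem gckyOp_eq_zero_of_isConformalKilling {K : Model D → Model D [⋀^Fin (q + 1)]→L[ℝ] ℝ}
    {y : Model D} (hs : ∀ u v, G y u v = G y v u) (hn : ∀ u, (∀ v, G y u v = 0) → u = 0)
    (h : IsConformalKilling (G y) (cov G T K y)) (v : Model D) (w : Fin (q + 1) → Model D) :
    gckyOp G T K y v w = 0 := by
  rw [gckyOp_eq]
  obtain hD | hD := eq_or_ne D q
  -- When `D = q` the trace cannot recover `β`, but forms of degree `q + 1 > D` vanish.
  · have hlt : Module.finrank ℝ (Model D) < q + 1 := by simp [hD]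
    rw [form_eq_zero_of_finrank_lt hlt (_ + _)]
    rfl
  obtain ⟨α, β, hA⟩ := h
  have hD' : (D : ℝ) - q ≠ 0 := sub_ne_zero.2 (by exact_mod_cast hD)
  have hq : (q : ℝ) + 2 ≠ 0 := by positivity
  have hAeq : cov G T K y = α.curryLeft + (wedge.flip β) ∘L G y := by
    ext1 u
    simp [hA]
  have halt : ContinuousAlternatingMap.alternatizeUncurryFin (cov G T K y) =
      ((q : ℝ) + 2) • α := by
    rw [hAeq, ContinuousAlternatingMap.alternatizeUncurryFin_add,
      alternatizeUncurryFin_wedge hs, add_zero,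
      ContinuousAlternatingMap.alternatizeUncurryFin_curryLeft, ← Nat.cast_smul_eq_nsmul ℝ]
    congr 1
    push_cast
    ring
  have hcod : codiff G y (cov G T K y) = -(((D : ℝ) - q) • β) := by
    simp only [codiff, hA, ContinuousAlternatingMap.curryLeft_add, add_apply,
      Finset.sum_add_distrib]
    rw [sum_curryLeft_dualVec hs hn, sum_curryLeft_wedge hs hn, zero_add]
  rw [halt, hcod, hA]
  simp [smul_smul, hq, hD']

end Connection

set_option maxSynthPendingDepth 3

/-! ### Conformal rescaling of metric and torsion. -/

section Conformal

variable {D p q : ℕ}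

/-- The endomorphism `v ↦ θ(u) v + θ(v) u - B(u, v) θ^♯`, the change of the Levi-Civita connection
under a conformal change of the metric. -/
def confDiff (B : Model D →L[ℝ] Model D →L[ℝ] ℝ) (θ : Model D →L[ℝ] ℝ) (u : Model D) :
    Model D →L[ℝ] Model D :=
  θ u • ContinuousLinearMap.id ℝ (Model D) + θ.smulRight u - (B u).smulRight (B.inverse θ)

theorem act_confDiff (B : Model D →L[ℝ] Model D →L[ℝ] ℝ) (θ : Model D →L[ℝ] ℝ) (u : Model D)
    (K : Model D [⋀^Fin (q + 1)]→L[ℝ] ℝ) :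
    act K (confDiff B θ u) = (((q + 1 : ℕ) : ℝ) + 1) • θ u • K - (wedge θ K).curryLeft u
      - wedge (B u) (K.curryLeft (B.inverse θ)) := by
  rw [confDiff, map_sub, map_add, map_smul, act_id, act_smulRight, act_smulRight, curryLeft_wedge]
  module

theorem metric_confDiff {B : Model D →L[ℝ] Model D →L[ℝ] ℝ}
    (hn : ∀ u, (∀ v, B u v = 0) → u = 0) (θ : Model D →L[ℝ] ℝ) (u v w : Model D) :
    B (confDiff B θ u v) w = θ u * B v w + θ v * B u w - B u v * θ w := by
  have := (isInvertible_of_nondegenerate hn).self_apply_inverse θ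
  simp [confDiff, this]

variable {G : Model D → Model D →L[ℝ] Model D →L[ℝ] ℝ} {T : Model D → Model D [⋀^Fin 3]→L[ℝ] ℝ}
  {φ : Model D → ℝ} {y : Model D}

/-- Both sides are compared after lowering an index with `φ² G`: the derivative of `φ²` in the
Koszul formula gives the three terms of `confDiff`, while the torsion and the metric scale alike. -/
theorem conn_conformal (hn : ∀ u, (∀ v, G y u v = 0) → u = 0)
    (hG : DifferentiableAt ℝ G y)
    (hφ : DifferentiableAt ℝ φ y) (h0 : φ y ≠ 0) (u : Model D) :
    conn (fun z => φ z ^ 2 • G z) (fun z => φ z ^ 2 • T z) y u =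
      conn G T y u + confDiff (G y) ((φ y)⁻¹ • fderiv ℝ φ y) u := by
  have h2 : φ y ^ 2 ≠ 0 := pow_ne_zero 2 h0
  have hn' : ∀ u, (∀ v, (fun z => φ z ^ 2 • G z) y u v = 0) → u = 0 := fun u hu =>
    hn u fun v => (mul_eq_zero.1 (by simpa using hu v : φ y ^ 2 * G y u v = 0)).resolve_left h2
  have hd : ∀ a b c, fderiv ℝ (fun z => φ z ^ 2 • G z) y a b c =
      φ y ^ 2 * fderiv ℝ G y a b c + 2 * φ y * fderiv ℝ φ y a * G y b c := by
    intro a b c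
    have h := fderiv_fun_smul (F := Model D →L[ℝ] Model D →L[ℝ] ℝ) (hφ.fun_pow 2) hG
    rw [fderiv_fun_pow 2 hφ] at h
    rw [show fderiv ℝ (fun z => φ z ^ 2 • G z) y = _ from h]
    simp
  ext1 v
  refine metric_ext (G := fun z => φ z ^ 2 • G z) hn' fun w => ?_
  simp only [conn_apply, add_apply, map_add]
  have h := metric_connT (G := fun z => φ z ^ 2 • G z) (fun z => φ z ^ 2 • T z) hn' u v w
  rw [hd, hd, hd] at h
  refine h.trans ?_
  simp only [smul_apply, ContinuousAlternatingMap.smul_apply, smul_eq_mul, metric_connT T hn,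
    metric_confDiff hn]
  field_simp
  ring

theorem cov_conformal (hn : ∀ u, (∀ v, G y u v = 0) → u = 0)
    (hG : DifferentiableAt ℝ G y) (hφ : DifferentiableAt ℝ φ y) (h0 : φ y ≠ 0)
    {K : Model D → Model D [⋀^Fin (q + 1)]→L[ℝ] ℝ} (hK : DifferentiableAt ℝ K y) (u : Model D) :
    cov (fun z => φ z ^ 2 • G z) (fun z => φ z ^ 2 • T z) (fun z => φ z ^ (q + 2) • K z) y u =
      φ y ^ (q + 2) • (cov G T K y u
        + (wedge ((φ y)⁻¹ • fderiv ℝ φ y) (K y)).curryLeft u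
        + wedge (G y u) ((K y).curryLeft ((G y).inverse ((φ y)⁻¹ • fderiv ℝ φ y)))) := by
  rw [cov_apply, cov_apply, conn_conformal hn hG hφ h0, fderiv_fun_smul (hφ.fun_pow _) hK,
    fderiv_fun_pow _ hφ]
  simp only [map_smul, map_add, smul_apply, add_apply, act_confDiff,
    ContinuousLinearMap.smulRight_apply]
  -- The derivative of the weight, `(q + 2) φ^(q+1) dφ`, equals `φ^(q+2) (p + 1) θ` with `p = q +
  -- 1`, `θ = φ⁻¹ dφ`; it cancels the first term of `act_confDiff`.
  have h : ((q + 2) • φ y ^ (q + 2 - 1)) • fderiv ℝ φ y u • K y =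
      φ y ^ (q + 2) • (((q + 1 : ℕ) : ℝ) + 1) • (φ y)⁻¹ • fderiv ℝ φ y u • K y := by
    simp only [smul_smul]
    congr 1
    rw [pow_succ (φ y) (q + 1)]
    simp
    field_simp
    ring
  rw [smul_assoc _ (fderiv ℝ φ y u), h]
  simp only [smul_assoc]
  module

theorem isConformalKilling_conformal (hn : ∀ u, (∀ v, G y u v = 0) → u = 0)
    (hG : DifferentiableAt ℝ G y) (hφ : DifferentiableAt ℝ φ y) (h0 : φ y ≠ 0)
    {K : Model D → Model D [⋀^Fin (q + 1)]→L[ℝ] ℝ} (hK : DifferentiableAt ℝ K y)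
    (h : IsConformalKilling (G y) (cov G T K y)) :
    IsConformalKilling (φ y ^ 2 • G y)
      (cov (fun z => φ z ^ 2 • G z) (fun z => φ z ^ 2 • T z) (fun z => φ z ^ (q + 2) • K z) y) := by
  obtain ⟨α, β, h⟩ := h
  -- The weight of the second form is only `φ^q` because `u^♭` is now taken with `φ² G`.
  refine ⟨φ y ^ (q + 2) • (α + wedge ((φ y)⁻¹ • fderiv ℝ φ y) (K y)), φ y ^ q • (β +
    (K y).curryLeft ((G y).inverse ((φ y)⁻¹ • fderiv ℝ φ y))), fun u => ?_⟩
  rw [cov_conformal hn hG hφ h0 hK, h]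
  simp only [ContinuousAlternatingMap.curryLeft_smul, ContinuousAlternatingMap.curryLeft_add,
    map_smul, map_add, smul_apply, add_apply]
  module

end Conformal

/-! ### Product rules for operator-valued maps. -/

section Derivatives

variable {E F F' : Type*} [NormedAddCommGroup E] [NormedSpace ℝ E]
    [NormedAddCommGroup F] [NormedSpace ℝ F] [NormedAddCommGroup F'] [NormedSpace ℝ F'] {y : E}

theorem fderiv_apply_const {H : E → F →L[ℝ] F'} (hH : DifferentiableAt ℝ H y) (a : E) (b : F) :
    fderiv ℝ (fun z => H z b) y a = fderiv ℝ H y a b := by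
  rw [fderiv_clm_apply hH (differentiableAt_const b)]
  simp

theorem fderiv_bilin_apply {H : E → F →L[ℝ] F →L[ℝ] F'} {P Q : E → F}
    (hH : DifferentiableAt ℝ H y) (hP : DifferentiableAt ℝ P y) (hQ : DifferentiableAt ℝ Q y)
    (a : E) : fderiv ℝ (fun z => H z (P z) (Q z)) y a =
      fderiv ℝ H y a (P y) (Q y) + H y (fderiv ℝ P y a) (Q y) + H y (P y) (fderiv ℝ Q y a) := by
  rw [fderiv_clm_apply (hH.clm_apply hP) hQ, fderiv_clm_apply hH hP]
  simp
  abel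

theorem fderiv_bilinear {X Y Z : Type*} [NormedAddCommGroup X] [NormedSpace ℝ X]
    [NormedAddCommGroup Y] [NormedSpace ℝ Y] [NormedAddCommGroup Z] [NormedSpace ℝ Z]
    (B : X →L[ℝ] Y →L[ℝ] Z) {P : E → X} {Q : E → Y} (hP : DifferentiableAt ℝ P y)
    (hQ : DifferentiableAt ℝ Q y) (a : E) :
    fderiv ℝ (fun z => B (P z) (Q z)) y a = B (fderiv ℝ P y a) (Q y) + B (P y) (fderiv ℝ Q y a) := by
  rw [B.fderiv_of_bilinear hP hQ]
  simp
  abel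

theorem differentiableAt_bilinear {X Y Z : Type*} [NormedAddCommGroup X] [NormedSpace ℝ X]
    [NormedAddCommGroup Y] [NormedSpace ℝ Y] [NormedAddCommGroup Z] [NormedSpace ℝ Z]
    (B : X →L[ℝ] Y →L[ℝ] Z) {P : E → X} {Q : E → Y} (hP : DifferentiableAt ℝ P y)
    (hQ : DifferentiableAt ℝ Q y) : DifferentiableAt ℝ (fun z => B (P z) (Q z)) y :=
  (B.hasFDerivAt_of_bilinear hP.hasFDerivAt hQ.hasFDerivAt).differentiableAt

end Derivatives

/-! ### Smoothness of the tensors built from the metric, the torsion and the form. -/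

section Smooth

variable {D p q : ℕ} {G : Model D → Model D →L[ℝ] Model D →L[ℝ] ℝ}
  {T : Model D → Model D [⋀^Fin 3]→L[ℝ] ℝ} {S : Set (Model D)}

theorem contDiffOn_metric_inverse (hG : ContDiffOn ℝ ∞ G S)
    (hn : ∀ y ∈ S, ∀ u, (∀ v, G y u v = 0) → u = 0) :
    ContDiffOn ℝ ∞ (fun y => (G y).inverse) S := fun y hy =>
  ((isInvertible_of_nondegenerate (hn y hy)).contDiffAt_map_inverse).comp_contDiffWithinAt y
    (hG y hy)

theorem contDiffOn_conn (hS : IsOpen S) (hG : ContDiffOn ℝ ∞ G S) (hT : ContDiffOn ℝ ∞ T S)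
    (hn : ∀ y ∈ S, ∀ u, (∀ v, G y u v = 0) → u = 0) : ContDiffOn ℝ ∞ (conn G T) S := by
  have hdG : ContDiffOn ℝ ∞ (fderiv ℝ G) S := hG.fderiv_of_isOpen hS (by simp)
  refine contDiffOn_clm_apply.2 fun u => contDiffOn_clm_apply.2 fun v => ?_
  simp only [conn_apply, connT_eq]
  refine (contDiffOn_metric_inverse hG hn).clm_apply (contDiffOn_clm_apply.2 fun w => ?_)
  simp only [connLow_apply]
  have h : ∀ a b c, ContDiffOn ℝ ∞ (fun y => fderiv ℝ G y a b c) S := fun a b c =>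
    ((hdG.clm_apply contDiffOn_const).clm_apply contDiffOn_const).clm_apply contDiffOn_const
  have h' : ContDiffOn ℝ ∞ (fun y => T y ![u, v, w]) S :=
    (ContinuousAlternatingMap.apply ℝ (Model D) ℝ ![u, v, w]).contDiff.comp_contDiffOn hT
  exact contDiffOn_const.mul ((((h u v w).add (h v u w)).sub (h w u v)).add h')

theorem contDiffOn_cov (hS : IsOpen S) (hG : ContDiffOn ℝ ∞ G S) (hT : ContDiffOn ℝ ∞ T S)
    (hn : ∀ y ∈ S, ∀ u, (∀ v, G y u v = 0) → u = 0)
    {K : Model D → Model D [⋀^Fin p]→L[ℝ] ℝ} (hK : ContDiffOn ℝ ∞ K S) :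
    ContDiffOn ℝ ∞ (cov G T K) S := by
  have h : ContDiffOn ℝ ∞ (fun y => act (K y)) S :=
    (act (E := Model D) (p := p)).contDiff.comp_contDiffOn hK
  have h' : ContDiffOn ℝ ∞ (fderiv ℝ K) S := hK.fderiv_of_isOpen hS (by simp)
  exact h'.sub (h.clm_comp (contDiffOn_conn hS hG hT hn))

theorem contDiffOn_alternatize {A : Model D → Model D →L[ℝ] Model D [⋀^Fin p]→L[ℝ] ℝ}
    (hA : ContDiffOn ℝ ∞ A S) :
    ContDiffOn ℝ ∞ (fun y => ContinuousAlternatingMap.alternatizeUncurryFin (A y)) S :=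
  (ContinuousAlternatingMap.alternatizeUncurryFinCLM ℝ (Model D) ℝ).contDiff.comp_contDiffOn hA

/-- `ContinuousAlternatingMap.curryLeft` as a continuous linear map. -/
def interior : (Model D [⋀^Fin (q + 1)]→L[ℝ] ℝ) →L[ℝ] Model D →L[ℝ] Model D [⋀^Fin q]→L[ℝ] ℝ :=
  (ContinuousAlternatingMap.curryLeftLI (𝕜 := ℝ) (E := Model D) (F := ℝ)).toContinuousLinearMap

theorem interior_apply (α : Model D [⋀^Fin (q + 1)]→L[ℝ] ℝ) : interior α = α.curryLeft := rfl

theorem contDiffOn_codiff (hG : ContDiffOn ℝ ∞ G S)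
    (hn : ∀ y ∈ S, ∀ u, (∀ v, G y u v = 0) → u = 0)
    {A : Model D → Model D →L[ℝ] Model D [⋀^Fin (q + 1)]→L[ℝ] ℝ} (hA : ContDiffOn ℝ ∞ A S) :
    ContDiffOn ℝ ∞ (fun y => codiff G y (A y)) S := by
  refine ContDiffOn.neg (ContDiffOn.sum fun a _ => ?_)
  exact (interior.contDiff.comp_contDiffOn (hA.clm_apply contDiffOn_const)).clm_apply
    ((contDiffOn_metric_inverse hG hn).clm_apply contDiffOn_const)

theorem contDiffOn_lieForm (hS : IsOpen S) {V : Model D → Model D} (hV : ContDiffOn ℝ ∞ V S)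
    {K : Model D → Model D [⋀^Fin p]→L[ℝ] ℝ} (hK : ContDiffOn ℝ ∞ K S) :
    ContDiffOn ℝ ∞ (lieForm V K) S := by
  have h : ContDiffOn ℝ ∞ (fun y => act (K y)) S :=
    (act (E := Model D) (p := p)).contDiff.comp_contDiffOn hK
  have h' : ContDiffOn ℝ ∞ (fderiv ℝ K) S := hK.fderiv_of_isOpen hS (by simp)
  have h'' : ContDiffOn ℝ ∞ (fderiv ℝ V) S := hV.fderiv_of_isOpen hS (by simp)
  exact (h'.clm_apply hV).add (h.clm_apply h'')

end Smooth

/-! ### Lie derivatives of the connection and of `∇^T K`. -/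

section Lie

variable {D p q : ℕ} {G : Model D → Model D →L[ℝ] Model D →L[ℝ] ℝ}
  {T : Model D → Model D [⋀^Fin 3]→L[ℝ] ℝ} {S : Set (Model D)} {V : Model D → Model D}
  {f : Model D → ℝ} {y : Model D}

theorem lieForm_eq (V : Model D → Model D) (K : Model D → Model D [⋀^Fin p]→L[ℝ] ℝ)
    (y : Model D) : lieForm V K y = fderiv ℝ K y (V y) + act (K y) (fderiv ℝ V y) := rfl

theorem lieBilin_apply (V : Model D → Model D) (G : Model D → Model D →L[ℝ] Model D →L[ℝ] ℝ)
    (y u v : Model D) : lieBilin V G y u v =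
      fderiv ℝ G y (V y) u v + G y (fderiv ℝ V y u) v + G y u (fderiv ℝ V y v) := rfl

theorem contDiffAt_sndFDeriv_symm {X : Type*} [NormedAddCommGroup X] [NormedSpace ℝ X]
    {H : Model D → X} (hS : IsOpen S) (hH : ContDiffOn ℝ ∞ H S) (hy : y ∈ S) (a b : Model D) :
    fderiv ℝ (fderiv ℝ H) y a b = fderiv ℝ (fderiv ℝ H) y b a :=
  ((hH.contDiffAt (hS.mem_nhds hy)).isSymmSndFDerivAt
    (by
      simp only [minSmoothness_of_isRCLikeNormedField]
      exact WithTop.coe_le_coe.2 (le_top : (2 : ℕ∞) ≤ ⊤))) a b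

theorem differentiableAt_of_contDiffOn {X : Type*} [NormedAddCommGroup X] [NormedSpace ℝ X]
    {H : Model D → X} (hS : IsOpen S) (hy : y ∈ S) (hH : ContDiffOn ℝ ∞ H S) :
    DifferentiableAt ℝ H y :=
  (hH.differentiableOn (by simp)).differentiableAt (hS.mem_nhds hy)

/-- The Lie derivative of the connection `C` along `V`. -/
def lieConn (V : Model D → Model D) (C : Model D → Model D →L[ℝ] Model D →L[ℝ] Model D)
    (y u : Model D) : Model D →L[ℝ] Model D :=
  fderiv ℝ (fderiv ℝ V) y u + fderiv ℝ C y (V y) u + C y (fderiv ℝ V y u)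
    + (C y u ∘L fderiv ℝ V y - fderiv ℝ V y ∘L C y u)

/-- The Lie derivative of a form valued covector. -/
def lieCovForm (V : Model D → Model D) (A : Model D → Model D →L[ℝ] Model D [⋀^Fin p]→L[ℝ] ℝ)
    (y u : Model D) : Model D [⋀^Fin p]→L[ℝ] ℝ :=
  fderiv ℝ A y (V y) u + A y (fderiv ℝ V y u) + act (A y u) (fderiv ℝ V y)

theorem fderiv_lieForm {K : Model D → Model D [⋀^Fin p]→L[ℝ] ℝ} (dK : DifferentiableAt ℝ K y)
    (dK' : DifferentiableAt ℝ (fderiv ℝ K) y) (dV : DifferentiableAt ℝ V y)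
    (dV' : DifferentiableAt ℝ (fderiv ℝ V) y) (u : Model D) :
    fderiv ℝ (lieForm V K) y u = fderiv ℝ (fderiv ℝ K) y u (V y) +
      fderiv ℝ K y (fderiv ℝ V y u) + act (fderiv ℝ K y u) (fderiv ℝ V y) +
      act (K y) (fderiv ℝ (fderiv ℝ V) y u) := by
  have h : lieForm V K = fun z => fderiv ℝ K z (V z) + act (K z) (fderiv ℝ V z) := rfl
  have h1 : DifferentiableAt ℝ (fun z => fderiv ℝ K z (V z)) y := dK'.clm_apply dV
  have h2 : DifferentiableAt ℝ (fun z => act (K z) (fderiv ℝ V z)) y :=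
    differentiableAt_bilinear (act (E := Model D) (p := p)) dK dV'
  rw [h, fderiv_fun_add h1 h2, add_apply, fderiv_bilinear (act (E := Model D) (p := p)) dK dV',
    fderiv_clm_apply dK' dV]
  simp
  abel

theorem fderiv_cov {K : Model D → Model D [⋀^Fin p]→L[ℝ] ℝ} (dK : DifferentiableAt ℝ K y)
    (dK' : DifferentiableAt ℝ (fderiv ℝ K) y) (dC : DifferentiableAt ℝ (conn G T) y)
    (dcov : DifferentiableAt ℝ (cov G T K) y) (a u : Model D) :
    fderiv ℝ (cov G T K) y a u = fderiv ℝ (fderiv ℝ K) y a u -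
      act (fderiv ℝ K y a) (conn G T y u) - act (K y) (fderiv ℝ (conn G T) y a u) := by
  have h1 : DifferentiableAt ℝ (fun z => fderiv ℝ K z u) y :=
    dK'.clm_apply (differentiableAt_const u)
  have h2 : DifferentiableAt ℝ (fun z => conn G T z u) y :=
    dC.clm_apply (differentiableAt_const u)
  have h3 : DifferentiableAt ℝ (fun z => act (K z) (conn G T z u)) y :=
    differentiableAt_bilinear (act (E := Model D) (p := p)) dK h2
  rw [← fderiv_apply_const dcov]
  simp only [cov_apply]
  rw [fderiv_fun_sub h1 h3, sub_apply,
    fderiv_bilinear (act (E := Model D) (p := p)) dK h2, fderiv_apply_const dK',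
    fderiv_apply_const dC]
  abel

/-- Second derivatives of `K` cancel by symmetry, and the commutator of the actions of `Γ(u, ·)` and
`∂V` supplies the last part of `lieConn`. -/
theorem cov_lieForm (hS : IsOpen S) (hG : ContDiffOn ℝ ∞ G S) (hT : ContDiffOn ℝ ∞ T S)
    (hn : ∀ y ∈ S, ∀ u, (∀ v, G y u v = 0) → u = 0)
    {K : Model D → Model D [⋀^Fin p]→L[ℝ] ℝ} (hK : ContDiffOn ℝ ∞ K S)
    (hV : ContDiffOn ℝ ∞ V S) (hy : y ∈ S) (u : Model D) :
    cov G T (lieForm V K) y u = lieCovForm V (cov G T K) y u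
      + act (K y) (lieConn V (conn G T) y u) := by
  have hK' : ContDiffOn ℝ ∞ (fderiv ℝ K) S := hK.fderiv_of_isOpen hS (by simp)
  have hV' : ContDiffOn ℝ ∞ (fderiv ℝ V) S := hV.fderiv_of_isOpen hS (by simp)
  have dK := differentiableAt_of_contDiffOn hS hy hK
  have dK' := differentiableAt_of_contDiffOn hS hy hK'
  have h1 := fderiv_lieForm dK dK' (differentiableAt_of_contDiffOn hS hy hV)
    (differentiableAt_of_contDiffOn hS hy hV') u
  have h2 := fderiv_cov dK dK' (differentiableAt_of_contDiffOn hS hy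
    (contDiffOn_conn hS hG hT hn)) (differentiableAt_of_contDiffOn hS hy
    (contDiffOn_cov hS hG hT hn hK)) (V y) u
  have h3 := act_act_sub (K y) (conn G T y u) (fderiv ℝ V y)
  rw [cov_apply, h1, lieCovForm, h2, lieConn, map_add, ← h3, cov_apply, cov_apply, lieForm_eq,
    contDiffAt_sndFDeriv_symm hS hK hy u (V y)]
  simp only [map_add, add_apply, map_sub, sub_apply]
  abel

/-- The equation defining the connection, differentiated along `e`. -/
theorem fderiv_metric_connT (hS : IsOpen S) (hn : ∀ y ∈ S, ∀ u, (∀ v, G y u v = 0) → u = 0)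
    (hy : y ∈ S) (dG : DifferentiableAt ℝ G y) (dG' : DifferentiableAt ℝ (fderiv ℝ G) y)
    (dT : DifferentiableAt ℝ T y) (dC : DifferentiableAt ℝ (conn G T) y) (e u v w : Model D) :
    fderiv ℝ G y e (connT G T y u v) w + G y (fderiv ℝ (conn G T) y e u v) w =
      1 / 2 * (fderiv ℝ (fderiv ℝ G) y e u v w + fderiv ℝ (fderiv ℝ G) y e v u w
        - fderiv ℝ (fderiv ℝ G) y e w u v + fderiv ℝ T y e ![u, v, w]) := by
  have dc : ∀ b : Model D, DifferentiableAt ℝ (fun _ : Model D => b) y := fun b =>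
    differentiableAt_const b
  have dC2 : ∀ a b, DifferentiableAt ℝ (fun z => conn G T z a b) y := fun a b =>
    (dC.clm_apply (dc a)).clm_apply (dc b)
  have dC2' : ∀ c a b, fderiv ℝ (fun z => conn G T z a b) y c = fderiv ℝ (conn G T) y c a b := by
    intro c a b
    rw [fderiv_apply_const (dC.clm_apply (dc a)), fderiv_apply_const dC]
  have dG1 : ∀ a, DifferentiableAt ℝ (fun z => fderiv ℝ G z a) y := fun a => dG'.clm_apply (dc a)
  have dG2 : ∀ a b c, DifferentiableAt ℝ (fun z => fderiv ℝ G z a b c) y := fun a b c =>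
    ((dG1 a).clm_apply (dc b)).clm_apply (dc c)
  have dG2' : ∀ e a b c, fderiv ℝ (fun z => fderiv ℝ G z a b c) y e =
      fderiv ℝ (fderiv ℝ G) y e a b c := by
    intro e a b c
    rw [fderiv_apply_const ((dG1 a).clm_apply (dc b)), fderiv_apply_const (dG1 a),
      fderiv_apply_const dG']
  have dT1 : ∀ m, DifferentiableAt ℝ (fun z => T z m) y := fun m =>
    dT.continuousAlternatingMap_apply_const m
  have dT1' : ∀ m e, fderiv ℝ (fun z => T z m) y e = fderiv ℝ T y e m := fun m e => by
    rw [fderiv_continuousAlternatingMap_apply_const_apply dT]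
  have h : (fun z => G z (conn G T z u v) w) =ᶠ[nhds y] fun z => 1 / 2 * (fderiv ℝ G z u v w +
      fderiv ℝ G z v u w - fderiv ℝ G z w u v + T z ![u, v, w]) := by
    filter_upwards [hS.mem_nhds hy] with z hz
    exact metric_connT T (hn z hz) u v w
  have h' := congrArg (fun L : Model D →L[ℝ] ℝ => L e) h.fderiv_eq
  rw [fderiv_bilin_apply dG (dC2 u v) (dc w), fderiv_const_mul
    (((dG2 u v w).fun_add (dG2 v u w)).fun_sub (dG2 w u v) |>.fun_add (dT1 _)),
    smul_apply, fderiv_fun_add (((dG2 u v w).fun_add (dG2 v u w)).fun_sub (dG2 w u v)) (dT1 _),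
    add_apply, fderiv_fun_sub ((dG2 u v w).fun_add (dG2 v u w)) (dG2 w u v), sub_apply,
    fderiv_fun_add (dG2 u v w) (dG2 v u w), add_apply, dC2', dG2', dG2', dG2', dT1'] at h'
  simpa using h'

/-- The conformal Killing equation, differentiated along `a`. -/
theorem fderiv_lieBilin (hS : IsOpen S) (hLG : ∀ z ∈ S, lieBilin V G z = (2 * f z) • G z)
    (hy : y ∈ S) (dG : DifferentiableAt ℝ G y) (dG' : DifferentiableAt ℝ (fderiv ℝ G) y)
    (dV : DifferentiableAt ℝ V y) (dV' : DifferentiableAt ℝ (fderiv ℝ V) y)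
    (df : DifferentiableAt ℝ f y) (a v w : Model D) :
    fderiv ℝ (fderiv ℝ G) y a (V y) v w + fderiv ℝ G y (fderiv ℝ V y a) v w
      + (fderiv ℝ G y a (fderiv ℝ V y v) w + G y (fderiv ℝ (fderiv ℝ V) y a v) w)
      + (fderiv ℝ G y a v (fderiv ℝ V y w) + G y v (fderiv ℝ (fderiv ℝ V) y a w)) =
      2 * fderiv ℝ f y a * G y v w + 2 * f y * fderiv ℝ G y a v w := by
  have dc : ∀ b : Model D, DifferentiableAt ℝ (fun _ : Model D => b) y := fun b =>
    differentiableAt_const b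
  have h : (fun z => fderiv ℝ G z (V z) v w + G z (fderiv ℝ V z v) w + G z v (fderiv ℝ V z w))
      =ᶠ[nhds y] fun z => 2 * f z * G z v w := by
    filter_upwards [hS.mem_nhds hy] with z hz
    rw [← lieBilin_apply, hLG z hz]
    rfl
  have h' := congrArg (fun L : Model D →L[ℝ] ℝ => L a) h.fderiv_eq
  have dVv : ∀ v, DifferentiableAt ℝ (fun z => fderiv ℝ V z v) y := fun v =>
    dV'.clm_apply (dc v)
  have dGV : DifferentiableAt ℝ (fun z => fderiv ℝ G z (V z)) y := dG'.clm_apply dV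
  have dGVv : DifferentiableAt ℝ (fun z => fderiv ℝ G z (V z) v) y := dGV.clm_apply (dc v)
  rw [fderiv_fun_add ((dGVv.clm_apply (dc w)).fun_add
      ((dG.clm_apply (dVv v)).clm_apply (dc w))) ((dG.clm_apply (dc v)).clm_apply (dVv w)),
    add_apply, fderiv_fun_add (dGVv.clm_apply (dc w)) ((dG.clm_apply (dVv v)).clm_apply (dc w)),
    add_apply, fderiv_apply_const dGVv, fderiv_apply_const dGV, fderiv_clm_apply dG' dV,
    fderiv_bilin_apply dG (dVv v) (dc w), fderiv_bilin_apply dG (dc v) (dVv w),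
    fderiv_fun_mul (df.const_mul 2) ((dG.clm_apply (dc v)).clm_apply (dc w)),
    fderiv_const_mul df] at h'
  simp only [add_apply, smul_apply] at h'
  rw [ fderiv_apply_const (dG.clm_apply (dc v)),
    fderiv_apply_const dG, fderiv_apply_const dV', fderiv_apply_const dV'] at h'
  simp at h'
  linarith

theorem lieForm_three (hLT : lieForm V T y = (2 * f y) • T y) (u v w : Model D) :
    fderiv ℝ T y (V y) ![u, v, w] + T y ![fderiv ℝ V y u, v, w] +
      T y ![u, fderiv ℝ V y v, w] + T y ![u, v, fderiv ℝ V y w] = 2 * f y * T y ![u, v, w] := by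
  have h := congrArg (fun L : Model D [⋀^Fin 3]→L[ℝ] ℝ => L ![u, v, w]) hLT
  simp only [lieForm_apply, Fin.sum_univ_three] at h
  have e0 : ∀ a b c d : Model D, Function.update ![a, b, c] 0 d = ![d, b, c] := by
    intro a b c d; funext i; fin_cases i <;> rfl
  have e1 : ∀ a b c d : Model D, Function.update ![a, b, c] 1 d = ![a, d, c] := by
    intro a b c d; funext i; fin_cases i <;> rfl
  have e2 : ∀ a b c d : Model D, Function.update ![a, b, c] 2 d = ![a, b, d] := by
    intro a b c d; funext i; fin_cases i <;> rfl
  rw [e0, e1, e2] at h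
  simp at h
  linarith

/-- The Koszul formula determines the connection from `g` and `T`, so its Lie derivative follows
from theirs. Terms in `f` itself cancel, as `g` and `T` scale by the same factor; only `df`
survives. -/
theorem lieConn_eq_confDiff (hS : IsOpen S) (hG : ContDiffOn ℝ ∞ G S) (hT : ContDiffOn ℝ ∞ T S)
    (hs : ∀ y ∈ S, ∀ u v, G y u v = G y v u) (hn : ∀ y ∈ S, ∀ u, (∀ v, G y u v = 0) → u = 0)
    (hV : ContDiffOn ℝ ∞ V S) (hf : ContDiffOn ℝ ∞ f S)
    (hLG : ∀ z ∈ S, lieBilin V G z = (2 * f z) • G z)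
    (hLT : ∀ z ∈ S, lieForm V T z = (2 * f z) • T z) (hy : y ∈ S) (u : Model D) :
    lieConn V (conn G T) y u = confDiff (G y) (fderiv ℝ f y) u := by
  have hG' : ContDiffOn ℝ ∞ (fderiv ℝ G) S := hG.fderiv_of_isOpen hS (by simp)
  have dG := differentiableAt_of_contDiffOn hS hy hG
  have dG' := differentiableAt_of_contDiffOn hS hy hG'
  have dT := differentiableAt_of_contDiffOn hS hy hT
  have df := differentiableAt_of_contDiffOn hS hy hf
  have dV := differentiableAt_of_contDiffOn hS hy hV
  have hV' : ContDiffOn ℝ ∞ (fderiv ℝ V) S := hV.fderiv_of_isOpen hS (by simp)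
  have dV' := differentiableAt_of_contDiffOn hS hy hV'
  have dC := differentiableAt_of_contDiffOn hS hy (contDiffOn_conn hS hG hT hn)
  have symV := contDiffAt_sndFDeriv_symm hS hV hy
  have symG := contDiffAt_sndFDeriv_symm hS hG hy
  have kill : ∀ v w, fderiv ℝ G y (V y) v w + G y (fderiv ℝ V y v) w + G y v (fderiv ℝ V y w) =
      2 * f y * G y v w := by
    intro v w
    rw [← lieBilin_apply, hLG y hy]
    rfl
  ext1 v
  refine metric_ext (hn y hy) fun w => ?_
  rw [metric_confDiff (hn y hy)]
  simp only [lieConn, add_apply, sub_apply, map_add, map_sub, ContinuousLinearMap.comp_apply,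
    conn_apply]
  have m1 := metric_connT T (hn y hy) (fderiv ℝ V y u) v w
  have m2 := metric_connT T (hn y hy) u (fderiv ℝ V y v) w
  have m3 := metric_connT T (hn y hy) u v (fderiv ℝ V y w)
  have m4 := metric_connT T (hn y hy) u v w
  have k1 := fderiv_metric_connT hS hn hy dG dG' dT dC (V y) u v w
  have k2 := kill (connT G T y u v) w
  have k3 := lieForm_three (hLT y hy) u v w
  have d1 := fderiv_lieBilin hS hLG hy dG dG' dV dV' df u v w
  have d2 := fderiv_lieBilin hS hLG hy dG dG' dV dV' df v u w
  have d3 := fderiv_lieBilin hS hLG hy dG dG' dV dV' df w u v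
  -- With mixed derivatives put in one order, `d1 + d2 - d3` repeats the Koszul pattern: the second
  -- derivatives of `V` add up to `2 g(∂_u ∂_v V, w)`.
  rw [symG u] at d1
  rw [symG v, symV v u] at d2
  rw [symG w, symV w u, symV w v, hs y hy _ v] at d3
  rw [m3, m4] at k2
  rw [m1, m2]
  linarith

end Lie

/-! ### Conformal symmetries in a coordinate patch. -/

section Local

variable {D p q : ℕ} {G : Model D → Model D →L[ℝ] Model D →L[ℝ] ℝ}
  {T : Model D → Model D [⋀^Fin 3]→L[ℝ] ℝ} {S : Set (Model D)} {V : Model D → Model D}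
  {f : Model D → ℝ} {y : Model D}

theorem contDiffOn_smul_bilin (hf : ContDiffOn ℝ ∞ f S) (hG : ContDiffOn ℝ ∞ G S) :
    ContDiffOn ℝ ∞ (fun z => f z • G z) S :=
  hf.smul hG

/-- The conformal factor of a conformal Killing vector field is smooth. -/
theorem contDiffOn_conformalFactor (hS : IsOpen S) (hG : ContDiffOn ℝ ∞ G S)
    (hn : ∀ y ∈ S, ∀ u, (∀ v, G y u v = 0) → u = 0) (hV : ContDiffOn ℝ ∞ V S)
    (hLG : ∀ z ∈ S, lieBilin V G z = (2 * f z) • G z) : ContDiffOn ℝ ∞ f S := by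
  intro y hy
  rcases Nat.eq_zero_or_pos D with rfl | hD
  -- In dimension zero the metric gives no information on `f`, but the model space is a single
  -- point.
  · have h : f = fun _ => f 0 := funext fun z => by rw [Subsingleton.elim z 0]
    rw [h]
    exact contDiffWithinAt_const
  obtain ⟨u, v, huv⟩ : ∃ u v, G y u v ≠ 0 := by
    by_contra! h
    have h0 := congrArg (fun w : Model D => w ⟨0, hD⟩) (hn y hy (basisVec ⟨0, hD⟩) (h _))
    simp [basisVec] at h0
  have hVd : ContDiffOn ℝ ∞ (fderiv ℝ V) S := hV.fderiv_of_isOpen hS (by simp)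
  have hGd : ContDiffOn ℝ ∞ (fderiv ℝ G) S := hG.fderiv_of_isOpen hS (by simp)
  have hGuv : ∀ {P Q : Model D → Model D}, ContDiffOn ℝ ∞ P S → ContDiffOn ℝ ∞ Q S →
      ContDiffOn ℝ ∞ (fun z => G z (P z) (Q z)) S := fun hP hQ => (hG.clm_apply hP).clm_apply hQ
  have hnum : ContDiffOn ℝ ∞ (fun z => lieBilin V G z u v) S := by
    simp only [lieBilin_apply]
    exact ((((hGd.clm_apply hV).clm_apply contDiffOn_const).clm_apply contDiffOn_const).add
      (hGuv (hVd.clm_apply contDiffOn_const) contDiffOn_const)).add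
      (hGuv contDiffOn_const (hVd.clm_apply contDiffOn_const))
  have hden : ContDiffOn ℝ ∞ (fun z => 2 * G z u v) S :=
    contDiffOn_const.mul (hGuv contDiffOn_const contDiffOn_const)
  have hdiv := (hnum y hy).div (hden y hy) (mul_ne_zero two_ne_zero huv)
  -- Near `y`, where `G(u, v) ≠ 0`, the factor is the quotient `(L_V G)(u, v) / (2 G(u, v))`.
  refine hdiv.congr_of_eventuallyEq ?_ ?_
  · have hne : ∀ᶠ z in nhdsWithin y S, 2 * G z u v ≠ 0 :=
      (hden.continuousOn y hy).eventually_ne (mul_ne_zero two_ne_zero huv)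
    filter_upwards [hne, self_mem_nhdsWithin] with z hz hzS
    rw [Pi.div_apply, hLG z hzS, eq_div_iff hz]
    change _ = (2 * f z) * G z u v
    ring
  · rw [Pi.div_apply, hLG y hy, eq_div_iff (mul_ne_zero two_ne_zero huv)]
    change _ = (2 * f y) * G y u v
    ring

theorem gckyOp_congr (G : Model D → Model D →L[ℝ] Model D →L[ℝ] ℝ)
    (T : Model D → Model D [⋀^Fin 3]→L[ℝ] ℝ) {K K' : Model D → Model D [⋀^Fin (q + 1)]→L[ℝ] ℝ}
    (h : K =ᶠ[nhds y] K') (v : Model D) (w : Fin (q + 1) → Model D) :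
    gckyOp G T K y v w = gckyOp G T K' y v w := by
  have hcov : cov G T K y = cov G T K' y := by
    rw [cov, cov, h.fderiv_eq, h.self_of_nhds]
  rw [gckyOp_eq, gckyOp_eq, hcov]

theorem cov_sub_smul {K₁ K : Model D → Model D [⋀^Fin p]→L[ℝ] ℝ}
    {h : Model D → ℝ} (d₁ : DifferentiableAt ℝ K₁ y) (d : DifferentiableAt ℝ K y)
    (dh : DifferentiableAt ℝ h y) (u : Model D) :
    cov G T (fun z => K₁ z - h z • K z) y u =
      cov G T K₁ y u - h y • cov G T K y u - fderiv ℝ h y u • K y := by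
  simp only [cov_apply]
  rw [fderiv_fun_sub d₁ (dh.fun_smul d), fderiv_fun_smul dh d]
  simp only [sub_apply, add_apply, smul_apply, map_sub, map_smul,
    ContinuousLinearMap.smulRight_apply]
  module

/-- Leibniz rule for `u ⌟ α + u^♭ ∧ β`; the middle term is again of the form `u^♭ ∧ β` once `L_V G`
is a multiple of `G`. -/
theorem lieCovForm_of_isConformalKilling
    {A : Model D → Model D →L[ℝ] Model D [⋀^Fin (q + 1)]→L[ℝ] ℝ}
    {α : Model D → Model D [⋀^Fin (q + 2)]→L[ℝ] ℝ} {β : Model D → Model D [⋀^Fin q]→L[ℝ] ℝ}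
    (hS : IsOpen S) (hy : y ∈ S) (dA : DifferentiableAt ℝ A y) (dα : DifferentiableAt ℝ α y)
    (dβ : DifferentiableAt ℝ β y) (dG : DifferentiableAt ℝ G y)
    (hA : ∀ z ∈ S, ∀ u, A z u = (α z).curryLeft u + wedge (G z u) (β z)) (u : Model D) :
    lieCovForm V A y u = (lieForm V α y).curryLeft u + wedge (lieBilin V G y u) (β y)
      + wedge (G y u) (lieForm V β y) := by
  have dGu : DifferentiableAt ℝ (fun z => G z u) y := dG.clm_apply (differentiableAt_const u)
  have dw : DifferentiableAt ℝ (fun z => wedge (G z u) (β z)) y :=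
    differentiableAt_bilinear (wedge (E := Model D) (q := q)) dGu dβ
  have da : DifferentiableAt ℝ (fun z => interior (α z)) y :=
    (interior (D := D) (q := q + 1)).differentiableAt.comp y dα
  have da' : DifferentiableAt ℝ (fun z => interior (α z) u) y :=
    da.clm_apply (differentiableAt_const u)
  have h : (fun z => A z u) =ᶠ[nhds y] fun z => interior (α z) u + wedge (G z u) (β z) := by
    filter_upwards [hS.mem_nhds hy] with z hz
    exact hA z hz u
  have h1 : fderiv ℝ A y (V y) u = (fderiv ℝ α y (V y)).curryLeft u +
      (wedge (fderiv ℝ G y (V y) u) (β y) + wedge (G y u) (fderiv ℝ β y (V y))) := by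
    rw [← fderiv_apply_const dA, h.fderiv_eq, fderiv_fun_add da' dw, add_apply,
      fderiv_bilinear (wedge (E := Model D) (q := q)) dGu dβ, fderiv_apply_const dG,
      fderiv_apply_const da]
    have h2 : fderiv ℝ (fun z => interior (α z)) y (V y) = interior (fderiv ℝ α y (V y)) := by
      have := (interior (D := D) (q := q + 1)).hasFDerivAt.comp y dα.hasFDerivAt
      exact congrArg (fun L => L (V y)) this.fderiv
    rw [h2, interior_apply]
  have hL : lieBilin V G y u = fderiv ℝ G y (V y) u + G y (fderiv ℝ V y u) +
      G y u ∘L fderiv ℝ V y := by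
    ext w
    exact lieBilin_apply V G y u w
  rw [lieCovForm, h1, hA y hy, hA y hy, hL, lieForm_eq, lieForm_eq, map_add act,
    add_apply, act_wedge, ContinuousAlternatingMap.curryLeft_add, add_apply, curryLeft_act]
  simp only [map_add, add_apply]
  abel

theorem gckyOp_lieForm (hS : IsOpen S) (hG : ContDiffOn ℝ ∞ G S) (hT : ContDiffOn ℝ ∞ T S)
    (hs : ∀ y ∈ S, ∀ u v, G y u v = G y v u) (hn : ∀ y ∈ S, ∀ u, (∀ v, G y u v = 0) → u = 0)
    (hV : ContDiffOn ℝ ∞ V S)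
    (hLG : ∀ z ∈ S, lieBilin V G z = (2 * f z) • G z)
    (hLT : ∀ z ∈ S, lieForm V T z = (2 * f z) • T z)
    {K : Model D → Model D [⋀^Fin (q + 1)]→L[ℝ] ℝ} (hK : ContDiffOn ℝ ∞ K S)
    (hE : ∀ z ∈ S, ∀ v w, gckyOp G T K z v w = 0) (hy : y ∈ S) (v : Model D)
    (w : Fin (q + 1) → Model D) :
    gckyOp G T (fun z => lieForm V K z - ((((q + 1 : ℕ) : ℝ) + 1) * f z) • K z) y v w = 0 := by
  have hf := contDiffOn_conformalFactor hS hG hn hV hLG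
  have hA := contDiffOn_cov hS hG hT hn hK
  -- Differentiating the decomposition needs `α` and `β` smooth in the point, so the explicit
  -- multiples of `d^T K` and `δ^T K` are used.
  set α : Model D → Model D [⋀^Fin (q + 2)]→L[ℝ] ℝ := fun z => (1 / ((q : ℝ) + 2)) •
        ContinuousAlternatingMap.alternatizeUncurryFin (cov G T K z) with hα
  set β : Model D → Model D [⋀^Fin q]→L[ℝ] ℝ := fun z =>
    -(1 / ((D : ℝ) - q)) • codiff G z (cov G T K z) with hβ
  have sα : ContDiffOn ℝ ∞ α S := (contDiffOn_alternatize hA).const_smul _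
  have sβ : ContDiffOn ℝ ∞ β S := (contDiffOn_codiff hG hn hA).const_smul _
  have hdec : ∀ z ∈ S, ∀ u, cov G T K z u = (α z).curryLeft u + wedge (G z u) (β z) :=
    fun z hz u => cov_eq_of_gckyOp_eq_zero T (hE z hz) u
  have df := differentiableAt_of_contDiffOn hS hy hf
  refine gckyOp_eq_zero_of_isConformalKilling T (hs y hy) (hn y hy) ?_ v w
  refine ⟨lieForm V α y - wedge (fderiv ℝ f y) (K y) - ((((q + 1 : ℕ) : ℝ) + 1) * f y) • α y,
    lieForm V β y + (2 * f y) • β y - (K y).curryLeft ((G y).inverse (fderiv ℝ f y))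
      - ((((q + 1 : ℕ) : ℝ) + 1) * f y) • β y, fun u => ?_⟩
  rw [cov_sub_smul (differentiableAt_of_contDiffOn hS hy (contDiffOn_lieForm hS hV hK))
    (differentiableAt_of_contDiffOn hS hy hK) (df.const_mul _), fderiv_const_mul df,
    cov_lieForm hS hG hT hn hK hV hy, lieConn_eq_confDiff hS hG hT hs hn hV hf hLG hLT hy,
    act_confDiff, lieCovForm_of_isConformalKilling hS hy (differentiableAt_of_contDiffOn hS hy hA)
      (differentiableAt_of_contDiffOn hS hy sα) (differentiableAt_of_contDiffOn hS hy sβ)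
      (differentiableAt_of_contDiffOn hS hy hG) hdec, hdec y hy, hLG y hy]
  simp only [sub_eq_add_neg, ← neg_smul, ContinuousAlternatingMap.curryLeft_add,
    ContinuousAlternatingMap.curryLeft_smul, map_add, map_smul, map_neg, add_apply, smul_apply]
  simp only [← interior_apply, map_neg]
  simp only [neg_apply]
  module

end Local

/-! ### Naturality of Lie derivatives under a change of coordinates. -/

section Pullback

variable {D p : ℕ} {φ : Model D → Model D} {y : Model D} {V V₀ : Model D → Model D}

theorem fderiv_related (hφ : DifferentiableAt ℝ φ y) (hφ' : DifferentiableAt ℝ (fderiv ℝ φ) y)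
    (dV : DifferentiableAt ℝ V y) (dV₀ : DifferentiableAt ℝ V₀ (φ y))
    (hV : ∀ᶠ z in nhds y, fderiv ℝ φ z (V z) = V₀ (φ z)) (u : Model D) :
    fderiv ℝ V₀ (φ y) (fderiv ℝ φ y u) =
      fderiv ℝ (fderiv ℝ φ) y u (V y) + fderiv ℝ φ y (fderiv ℝ V y u) := by
  have h : (fun z => fderiv ℝ φ z (V z)) =ᶠ[nhds y] V₀ ∘ φ := hV
  have h' := h.fderiv_eq (𝕜 := ℝ)
  rw [fderiv_clm_apply hφ' dV, fderiv_comp y dV₀ hφ] at h'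
  have h'' := congrArg (fun L : Model D →L[ℝ] Model D => L u) h'
  simp at h''
  rw [← h'', add_comm]

/-- The second derivatives of `φ` produced by differentiating the pullback are exactly those in
`fderiv_related`, by symmetry of the Hessian. No inverse of `φ` is needed. -/
theorem lieForm_pullback (hφ : DifferentiableAt ℝ φ y) (hφ' : DifferentiableAt ℝ (fderiv ℝ φ) y)
    (hsymm : ∀ a b, fderiv ℝ (fderiv ℝ φ) y a b = fderiv ℝ (fderiv ℝ φ) y b a)
    (dV : DifferentiableAt ℝ V y) (dV₀ : DifferentiableAt ℝ V₀ (φ y))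
    (hV : ∀ᶠ z in nhds y, fderiv ℝ φ z (V z) = V₀ (φ z))
    {K K₀ : Model D → Model D [⋀^Fin p]→L[ℝ] ℝ} (dK₀ : DifferentiableAt ℝ K₀ (φ y))
    (hK : ∀ᶠ z in nhds y, K z = (K₀ (φ z)).compContinuousLinearMap (fderiv ℝ φ z)) :
    lieForm V K y = (lieForm V₀ K₀ (φ y)).compContinuousLinearMap (fderiv ℝ φ y) := by
  have dKφ : DifferentiableAt ℝ (fun z => K₀ (φ z)) y := dK₀.comp y hφ
  have h : K =ᶠ[nhds y] fun z => (K₀ (φ z)).compContinuousLinearMap (fderiv ℝ φ z) := hK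
  have hVy : fderiv ℝ φ y (V y) = V₀ (φ y) := hV.self_of_nhds
  have hKφ : fderiv ℝ (fun z => K₀ (φ z)) y (V y) = fderiv ℝ K₀ (φ y) (V₀ (φ y)) := by
    have h1 : fderiv ℝ (K₀ ∘ φ) y (V y) = _ :=
      congrArg (fun L : Model D →L[ℝ] Model D [⋀^Fin p]→L[ℝ] ℝ => L (V y)) (fderiv_comp y dK₀ hφ)
    exact h1.trans (congrArg _ hVy)
  ext w
  rw [lieForm_apply, h.fderiv_eq,
    fderiv_continuousAlternatingMapCompContinuousLinearMap dKφ hφ', hK.self_of_nhds]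
  simp only [add_apply, ContinuousLinearMap.comp_apply, hKφ,
    ContinuousAlternatingMap.add_apply, ContinuousAlternatingMap.compContinuousLinearMap_apply,
    ContinuousAlternatingMap.compContinuousLinearMapCLM_apply,
    ContinuousAlternatingMap.fderivCompContinuousLinearMap_apply, lieForm_apply]
  rw [add_assoc, ← Finset.sum_add_distrib]
  congr 1
  refine Finset.sum_congr rfl fun i _ => ?_
  have e1 : (fun j => Function.update (fun _ => fderiv ℝ φ y) i
      (fderiv ℝ (fderiv ℝ φ) y (V y)) j (w j)) =
      Function.update (⇑(fderiv ℝ φ y) ∘ w) i (fderiv ℝ (fderiv ℝ φ) y (w i) (V y)) := by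
    funext j
    rcases eq_or_ne j i with rfl | hj
    · simp [hsymm]
    · simp [hj]
  have e2 : ⇑(fderiv ℝ φ y) ∘ Function.update w i (fderiv ℝ V y (w i)) =
      Function.update (⇑(fderiv ℝ φ y) ∘ w) i (fderiv ℝ φ y (fderiv ℝ V y (w i))) :=
    Function.comp_update _ _ _ _
  rw [e1, e2, Function.comp_apply, fderiv_related hφ hφ' dV dV₀ hV,
    ContinuousAlternatingMap.map_update_add]

theorem lieBilin_pullback (hφ : DifferentiableAt ℝ φ y) (hφ' : DifferentiableAt ℝ (fderiv ℝ φ) y)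
    (hsymm : ∀ a b, fderiv ℝ (fderiv ℝ φ) y a b = fderiv ℝ (fderiv ℝ φ) y b a)
    (dV : DifferentiableAt ℝ V y) (dV₀ : DifferentiableAt ℝ V₀ (φ y))
    (hV : ∀ᶠ z in nhds y, fderiv ℝ φ z (V z) = V₀ (φ z))
    {G G₀ : Model D → Model D →L[ℝ] Model D →L[ℝ] ℝ} (dG : DifferentiableAt ℝ G y)
    (dG₀ : DifferentiableAt ℝ G₀ (φ y))
    (hG : ∀ᶠ z in nhds y, ∀ u v, G z u v = G₀ (φ z) (fderiv ℝ φ z u) (fderiv ℝ φ z v))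
    (u v : Model D) : lieBilin V G y u v =
      lieBilin V₀ G₀ (φ y) (fderiv ℝ φ y u) (fderiv ℝ φ y v) := by
  have dGφ : DifferentiableAt ℝ (fun z => G₀ (φ z)) y := dG₀.comp y hφ
  have dφu : ∀ u, DifferentiableAt ℝ (fun z => fderiv ℝ φ z u) y := fun u =>
    hφ'.clm_apply (differentiableAt_const u)
  have dGu : DifferentiableAt ℝ (fun z => G z u) y := dG.clm_apply (differentiableAt_const u)
  have h : (fun z => G z u v) =ᶠ[nhds y] fun z =>
      G₀ (φ z) (fderiv ℝ φ z u) (fderiv ℝ φ z v) := by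
    filter_upwards [hG] with z hz
    exact hz u v
  have hVy : fderiv ℝ φ y (V y) = V₀ (φ y) := hV.self_of_nhds
  have hGφ : fderiv ℝ (fun z => G₀ (φ z)) y (V y) = fderiv ℝ G₀ (φ y) (V₀ (φ y)) := by
    have h1 : fderiv ℝ (G₀ ∘ φ) y (V y) = _ :=
      congrArg (fun L : Model D →L[ℝ] Model D →L[ℝ] Model D →L[ℝ] ℝ => L (V y))
        (fderiv_comp y dG₀ hφ)
    exact h1.trans (congrArg _ hVy)
  have hGy := hG.self_of_nhds
  have h1 : fderiv ℝ G y (V y) u v = fderiv ℝ G₀ (φ y) (V₀ (φ y)) (fderiv ℝ φ y u) (fderiv ℝ φ y v)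
      + G₀ (φ y) (fderiv ℝ (fderiv ℝ φ) y (V y) u) (fderiv ℝ φ y v)
      + G₀ (φ y) (fderiv ℝ φ y u) (fderiv ℝ (fderiv ℝ φ) y (V y) v) := by
    rw [← fderiv_apply_const dG, ← fderiv_apply_const dGu, h.fderiv_eq,
      fderiv_bilin_apply dGφ (dφu u) (dφu v), hGφ, fderiv_apply_const hφ', fderiv_apply_const hφ']
  rw [lieBilin_apply, lieBilin_apply, h1, hGy, hGy, fderiv_related hφ hφ' dV dV₀ hV,
    fderiv_related hφ hφ' dV dV₀ hV, hsymm u, hsymm v]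
  simp only [map_add, add_apply]
  ring

end Pullback

/-! ### Coordinate expressions in different charts. -/

section Charts

variable {D p : ℕ} {M : Type*} [TopologicalSpace M] [ChartedSpace (Model D) M]
  [IsManifold (𝓡 D) ∞ M] {e e₀ : OpenPartialHomeomorph M (Model D)} {z : Model D}

theorem chart_mdifferentiable (he : e ∈ atlas (Model D) M) : e.MDifferentiable (𝓡 D) (𝓡 D) :=
  haveI : IsManifold (𝓡 D) 1 M := IsManifold.of_le (n := ∞) (by simp)
  mdifferentiable_of_mem_atlas he

theorem mfderiv_symm_mfderiv (he : e ∈ atlas (Model D) M) {x : M} (hx : x ∈ e.source) :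
    (mfderiv (𝓡 D) (𝓡 D) e.symm (e x)) ∘L (mfderiv (𝓡 D) (𝓡 D) e x) =
      ContinuousLinearMap.id ℝ (TangentSpace (𝓡 D) x) :=
  (chart_mdifferentiable he).symm_comp_deriv hx

theorem mfderiv_mfderiv_symm (he : e ∈ atlas (Model D) M) (hz : z ∈ e.target) :
    (mfderiv (𝓡 D) (𝓡 D) e (e.symm z)) ∘L (mfderiv (𝓡 D) (𝓡 D) e.symm z) =
      ContinuousLinearMap.id ℝ (Model D) :=
  (chart_mdifferentiable he).comp_symm_deriv hz

theorem mfderiv_symm_apply_mfderiv (he : e ∈ atlas (Model D) M) (hz : z ∈ e.target)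
    (u : TangentSpace (𝓡 D) (e.symm z)) :
    mfderiv (𝓡 D) (𝓡 D) e.symm z (mfderiv (𝓡 D) (𝓡 D) e (e.symm z) u) = u := by
  have h := mfderiv_symm_mfderiv he (e.map_target hz)
  rw [e.right_inv hz] at h
  exact DFunLike.congr_fun h u

theorem mfderiv_apply_mfderiv_symm (he : e ∈ atlas (Model D) M) (hz : z ∈ e.target) (u : Model D) :
    mfderiv (𝓡 D) (𝓡 D) e (e.symm z) (mfderiv (𝓡 D) (𝓡 D) e.symm z u) = u :=
  DFunLike.congr_fun (mfderiv_mfderiv_symm he hz) u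

theorem isInvertible_mfderiv_symm (he : e ∈ atlas (Model D) M) (hz : z ∈ e.target) :
    (mfderiv (𝓡 D) (𝓡 D) e.symm z).IsInvertible :=
  ContinuousLinearMap.IsInvertible.of_inverse
    (g := (mfderiv (𝓡 D) (𝓡 D) e (e.symm z) : TangentSpace (𝓡 D) (e.symm z) →L[ℝ] Model D))
    (by ext1 u; exact mfderiv_symm_apply_mfderiv he hz u)
    (by ext1 u; exact mfderiv_apply_mfderiv_symm he hz u)

theorem isInvertible_mfderiv (he : e ∈ atlas (Model D) M) {x : M} (hx : x ∈ e.source) :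
    (mfderiv (𝓡 D) (𝓡 D) e x).IsInvertible :=
  ContinuousLinearMap.IsInvertible.of_inverse
    (g := (mfderiv (𝓡 D) (𝓡 D) e.symm (e x) : Model D →L[ℝ] TangentSpace (𝓡 D) (e.symm (e x))))
    (by
      have h := mfderiv_mfderiv_symm he (e.map_source hx)
      rw [e.left_inv hx] at h
      exact h)
    (mfderiv_symm_mfderiv he hx)

/-- The inverse of the derivative of a chart at a point. -/
def chartFrame (e : OpenPartialHomeomorph M (Model D)) (x : M) :
    Model D →L[ℝ] TangentSpace (𝓡 D) x :=
  (mfderiv (𝓡 D) (𝓡 D) e x).inverse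

theorem chartFrame_mfderiv (he : e ∈ atlas (Model D) M) {x : M} (hx : x ∈ e.source)
    (u : TangentSpace (𝓡 D) x) : chartFrame e x (mfderiv (𝓡 D) (𝓡 D) e x u) = u :=
  (isInvertible_mfderiv he hx).inverse_apply_self u

theorem chartFrame_symm (he : e ∈ atlas (Model D) M) (hz : z ∈ e.target) (u : Model D) :
    chartFrame e (e.symm z) u = mfderiv (𝓡 D) (𝓡 D) e.symm z u := by
  conv_lhs => rw [← mfderiv_apply_mfderiv_symm he hz u]
  exact chartFrame_mfderiv he (e.map_target hz) _

/-- `chartFrame e x` lands in the tangent space at `x` itself, whereas the derivative of `e.symm` at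
`e x` lands over `e.symm (e x)`; this lets two charts be compared at one point. -/
theorem localForm_chart (he : e ∈ atlas (Model D) M) {x : M} (hx : x ∈ e.source)
    (k : FormField D M p) (w : Fin p → Model D) :
    localForm e k (e x) w = k x (fun i => chartFrame e x (w i)) := by
  have h : ∀ x', x' = x → k x' (fun i => chartFrame e x' (w i)) =
      k x (fun i => chartFrame e x (w i)) := by
    rintro _ rfl
    rfl
  rw [← h _ (e.left_inv hx)]
  simp only [chartFrame_symm he (e.map_source hx)]
  rfl

theorem localBilin_chart (he : e ∈ atlas (Model D) M) {x : M} (hx : x ∈ e.source)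
    (g : BilinField D M) (u v : Model D) :
    localBilin e g (e x) u v = g x (chartFrame e x u) (chartFrame e x v) := by
  have h : ∀ x', x' = x → g x' (chartFrame e x' u) (chartFrame e x' v) =
      g x (chartFrame e x u) (chartFrame e x v) := by
    rintro _ rfl
    rfl
  rw [← h _ (e.left_inv hx), chartFrame_symm he (e.map_source hx),
    chartFrame_symm he (e.map_source hx)]
  rfl

theorem localVec_target (he : e ∈ atlas (Model D) M) (hz : z ∈ e.target) (ξ : VecField D M) :
    localVec e ξ z = mfderiv (𝓡 D) (𝓡 D) e (e.symm z) (ξ (e.symm z)) := by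
  have h : mfderiv (𝓡 D) (𝓡 D) e.symm z
      (mfderiv (𝓡 D) (𝓡 D) e (e.symm z) (ξ (e.symm z))) = ξ (e.symm z) :=
    mfderiv_symm_apply_mfderiv he hz _
  exact ((isInvertible_mfderiv_symm he hz).inverse_apply_eq).2 h.symm

theorem localVec_chart (he : e ∈ atlas (Model D) M) {x : M} (hx : x ∈ e.source)
    (ξ : VecField D M) : localVec e ξ (e x) = mfderiv (𝓡 D) (𝓡 D) e x (ξ x) := by
  have h : ∀ x', x' = x → (mfderiv (𝓡 D) (𝓡 D) e x' (ξ x') : Model D) =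
      mfderiv (𝓡 D) (𝓡 D) e x (ξ x) := by
    rintro _ rfl
    rfl
  exact (localVec_target he (e.map_source hx) ξ).trans (h _ (e.left_inv hx))

theorem mfderiv_transition (he : e ∈ atlas (Model D) M) (he₀ : e₀ ∈ atlas (Model D) M)
    (hz : z ∈ e.target) (hz₀ : e.symm z ∈ e₀.source) (u : Model D) :
    fderiv ℝ (e₀ ∘ e.symm) z u =
      mfderiv (𝓡 D) (𝓡 D) e₀ (e.symm z) (mfderiv (𝓡 D) (𝓡 D) e.symm z u) := by
  rw [← mfderiv_eq_fderiv, mfderiv_comp z ((chart_mdifferentiable he₀).mdifferentiableAt hz₀)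
    ((chart_mdifferentiable he).mdifferentiableAt_symm hz)]
  rfl

theorem chartFrame_transition (he : e ∈ atlas (Model D) M) (he₀ : e₀ ∈ atlas (Model D) M)
    (hz : z ∈ e.target) (hz₀ : e.symm z ∈ e₀.source) (u : Model D) :
    chartFrame e₀ (e.symm z) (fderiv ℝ (e₀ ∘ e.symm) z u) =
      mfderiv (𝓡 D) (𝓡 D) e.symm z u := by
  rw [mfderiv_transition he he₀ hz hz₀, chartFrame_mfderiv he₀ hz₀]

theorem localForm_transition (he : e ∈ atlas (Model D) M) (he₀ : e₀ ∈ atlas (Model D) M)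
    (hz : z ∈ e.target) (hz₀ : e.symm z ∈ e₀.source) (k : FormField D M p) :
    localForm e k z = (localForm e₀ k ((e₀ ∘ e.symm) z)).compContinuousLinearMap
      (fderiv ℝ (e₀ ∘ e.symm) z) := by
  ext w
  refine Eq.trans ?_ (localForm_chart he₀ hz₀ k _).symm
  refine congrArg (k (e.symm z)) (funext fun i => ?_)
  exact (chartFrame_transition he he₀ hz hz₀ (w i)).symm

theorem localBilin_transition (he : e ∈ atlas (Model D) M) (he₀ : e₀ ∈ atlas (Model D) M)
    (hz : z ∈ e.target) (hz₀ : e.symm z ∈ e₀.source) (g : BilinField D M) (u v : Model D) :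
    localBilin e g z u v = localBilin e₀ g ((e₀ ∘ e.symm) z)
      (fderiv ℝ (e₀ ∘ e.symm) z u) (fderiv ℝ (e₀ ∘ e.symm) z v) := by
  refine Eq.trans ?_ (localBilin_chart he₀ hz₀ g _ _).symm
  rw [chartFrame_transition he he₀ hz hz₀, chartFrame_transition he he₀ hz hz₀]
  rfl

theorem localVec_transition (he : e ∈ atlas (Model D) M) (he₀ : e₀ ∈ atlas (Model D) M)
    (hz : z ∈ e.target) (hz₀ : e.symm z ∈ e₀.source) (ξ : VecField D M) :
    fderiv ℝ (e₀ ∘ e.symm) z (localVec e ξ z) = localVec e₀ ξ ((e₀ ∘ e.symm) z) := by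
  refine Eq.trans ?_ (localVec_chart he₀ hz₀ ξ).symm
  rw [mfderiv_transition he he₀ hz hz₀, localVec_target he hz]
  exact congrArg _ (mfderiv_symm_apply_mfderiv he hz _)

theorem contDiffOn_transition (he : e ∈ atlas (Model D) M) (he₀ : e₀ ∈ atlas (Model D) M) :
    ContDiffOn ℝ ∞ (e₀ ∘ e.symm) (e.symm.trans e₀).source := by
  intro z hz
  rw [OpenPartialHomeomorph.trans_source, OpenPartialHomeomorph.symm_source] at hz
  have h := (contMDiffAt_of_mem_maximalAtlas (I := 𝓡 D) (n := ∞)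
    (IsManifold.subset_maximalAtlas he₀) hz.2).comp z
    (contMDiffAt_symm_of_mem_maximalAtlas (IsManifold.subset_maximalAtlas he) hz.1)
  exact h.contDiffAt.contDiffWithinAt

theorem contDiffOn_localVec (he : e ∈ atlas (Model D) M) {ξ : VecField D M}
    (hξ : IsSmoothVec ξ) : ContDiffOn ℝ ∞ (localVec e ξ) e.target := by
  intro z hz
  have : IsManifold (𝓡 D) 1 M := IsManifold.of_le (n := ∞) (by simp)
  have h := ContMDiffAt.mpullback_vectorField_preimage (m := ∞) (n := ∞) (hξ (e.symm z))
    (contMDiffAt_symm_of_mem_maximalAtlas (IsManifold.subset_maximalAtlas he) hz)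
    (isInvertible_mfderiv_symm he hz) (by simp)
  exact (contMDiffAt_vectorSpace_iff_contDiffAt.1 h).contDiffWithinAt

theorem localForm_lieDerivForm (he : e ∈ atlas (Model D) M) {ξ : VecField D M}
    (hξ : IsSmoothVec ξ) {k : FormField D M p} (hk : IsSmoothForm k) (hz : z ∈ e.target) :
    localForm e (lieDerivForm ξ k) z = lieForm (localVec e ξ) (localForm e k) z := by
  -- The global Lie derivative uses a chart depending on the point; freezing the one at `e.symm z`
  -- suffices, since the identity is pointwise.
  set e₀ := chartAt (Model D) (e.symm z)
  have he₀ : e₀ ∈ atlas (Model D) M := chart_mem_atlas _ _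
  have hz₀ : e.symm z ∈ e₀.source := mem_chart_source _ _
  have hS : IsOpen (e.symm.trans e₀).source := (e.symm.trans e₀).open_source
  have hzS : z ∈ (e.symm.trans e₀).source := by simp [hz, hz₀]
  have hφ := contDiffOn_transition he he₀
  have hφ' : ContDiffOn ℝ ∞ (fderiv ℝ (e₀ ∘ e.symm)) (e.symm.trans e₀).source :=
    hφ.fderiv_of_isOpen hS (by simp)
  have hev : ∀ᶠ z' in nhds z, z' ∈ e.target ∧ e.symm z' ∈ e₀.source := by
    filter_upwards [hS.mem_nhds hzS] with z' hz'
    simpa using hz'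
  rw [lieForm_pullback (V₀ := localVec e₀ ξ) (K₀ := localForm e₀ k)
    (differentiableAt_of_contDiffOn hS hzS hφ) (differentiableAt_of_contDiffOn hS hzS hφ')
    (contDiffAt_sndFDeriv_symm hS hφ hzS)
    (differentiableAt_of_contDiffOn e.open_target hz (contDiffOn_localVec he hξ))
    (differentiableAt_of_contDiffOn e₀.open_target (e₀.map_source hz₀)
      (contDiffOn_localVec he₀ hξ))
    (hev.mono fun z' h => localVec_transition he he₀ h.1 h.2 ξ)
    (differentiableAt_of_contDiffOn e₀.open_target (e₀.map_source hz₀) (hk e₀ he₀))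
    (hev.mono fun z' h => localForm_transition he he₀ h.1 h.2 k)]
  ext w
  refine congrArg (lieForm (localVec e₀ ξ) (localForm e₀ k) (e₀ (e.symm z)))
    (funext fun i => ?_)
  exact (mfderiv_transition he he₀ hz hz₀ (w i)).symm

theorem localBilin_lieDerivBilin (he : e ∈ atlas (Model D) M) {ξ : VecField D M}
    (hξ : IsSmoothVec ξ) {g : BilinField D M} (hg : IsPseudoRiemannianMetric g)
    (hz : z ∈ e.target) :
    localBilin e (lieDerivBilin ξ g) z = lieBilin (localVec e ξ) (localBilin e g) z := by
  set e₀ := chartAt (Model D) (e.symm z)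
  have he₀ : e₀ ∈ atlas (Model D) M := chart_mem_atlas _ _
  have hz₀ : e.symm z ∈ e₀.source := mem_chart_source _ _
  have hS : IsOpen (e.symm.trans e₀).source := (e.symm.trans e₀).open_source
  have hzS : z ∈ (e.symm.trans e₀).source := by simp [hz, hz₀]
  have hφ := contDiffOn_transition he he₀
  have hφ' : ContDiffOn ℝ ∞ (fderiv ℝ (e₀ ∘ e.symm)) (e.symm.trans e₀).source :=
    hφ.fderiv_of_isOpen hS (by simp)
  have hev : ∀ᶠ z' in nhds z, z' ∈ e.target ∧ e.symm z' ∈ e₀.source := by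
    filter_upwards [hS.mem_nhds hzS] with z' hz'
    simpa using hz'
  ext u v
  rw [lieBilin_pullback (V₀ := localVec e₀ ξ) (G₀ := localBilin e₀ g)
    (differentiableAt_of_contDiffOn hS hzS hφ) (differentiableAt_of_contDiffOn hS hzS hφ')
    (contDiffAt_sndFDeriv_symm hS hφ hzS)
    (differentiableAt_of_contDiffOn e.open_target hz (contDiffOn_localVec he hξ))
    (differentiableAt_of_contDiffOn e₀.open_target (e₀.map_source hz₀)
      (contDiffOn_localVec he₀ hξ))
    (hev.mono fun z' h => localVec_transition he he₀ h.1 h.2 ξ)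
    (differentiableAt_of_contDiffOn e.open_target hz (hg.smooth e he))
    (differentiableAt_of_contDiffOn e₀.open_target (e₀.map_source hz₀) (hg.smooth e₀ he₀))
    (hev.mono fun z' h => localBilin_transition he he₀ h.1 h.2 g),
    mfderiv_transition he he₀ hz hz₀, mfderiv_transition he he₀ hz hz₀]
  rfl

theorem localBilin_nondegenerate (he : e ∈ atlas (Model D) M) {g : BilinField D M}
    (hg : IsPseudoRiemannianMetric g) (hz : z ∈ e.target) (u : Model D)
    (h : ∀ v, localBilin e g z u v = 0) : u = 0 := by
  have hu : mfderiv (𝓡 D) (𝓡 D) e.symm z u = 0 := by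
    refine hg.nondegenerate _ _ fun v => ?_
    rw [← mfderiv_symm_apply_mfderiv he hz v]
    exact h _
  rw [← mfderiv_apply_mfderiv_symm he hz u, hu]
  exact map_zero _

end Charts

end KillingYano

end

open KillingYano

/-! ### Globalization: both claims are checked chart by chart. -/

theorem lemma1 (D p : ℕ) (M : Type*) [TopologicalSpace M] [ChartedSpace (Model D) M]
    [IsManifold (𝓡 D) ∞ M]
    (g : BilinField D M) (hg : IsPseudoRiemannianMetric g)
    (T : FormField D M 3) (hT : IsSmoothForm T)
    (k : FormField D M p) (hk : IsGCKY g T k) :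
    (∀ Ω : M → ℝ, ContMDiff (𝓡 D) 𝓘(ℝ, ℝ) ∞ Ω → (∀ x, Ω x ≠ 0) →
      IsPseudoRiemannianMetric (fun x => Ω x ^ 2 • g x) ∧
      IsSmoothForm (fun x => Ω x ^ 2 • T x) ∧
      IsGCKY (fun x => Ω x ^ 2 • g x) (fun x => Ω x ^ 2 • T x)
        (fun x => Ω x ^ (p + 1) • k x)) ∧
    (∀ (ξ : VecField D M) (f : M → ℝ), IsSmoothVec ξ →
      (∀ x, lieDerivBilin ξ g x = (2 * f x) • g x) →
      (∀ x, lieDerivForm ξ T x = (2 * f x) • T x) →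
      IsGCKY g T (fun x => lieDerivForm ξ k x - (((p : ℝ) + 1) * f x) • k x)) := by
  have hs : ∀ e ∈ atlas (Model D) M, ∀ y ∈ e.target, ∀ u v,
      localBilin e g y u v = localBilin e g y v u := fun _ _ _ _ _ _ => hg.symm _ _ _
  have hn : ∀ e ∈ atlas (Model D) M, ∀ y ∈ e.target, ∀ u,
      (∀ v, localBilin e g y u v = 0) → u = 0 := fun e he y hy =>
    localBilin_nondegenerate he hg hy
  refine ⟨fun Ω hΩ hΩ0 => ?_, fun ξ f hξ hLg hLT => ?_⟩
  · have hφ : ∀ e ∈ atlas (Model D) M, ContDiffOn ℝ ∞ (fun y => Ω (e.symm y)) e.target :=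
      fun e he y hy => ((hΩ.contMDiffAt).comp y (contMDiffAt_symm_of_mem_maximalAtlas
        (IsManifold.subset_maximalAtlas he) hy)).contDiffAt.contDiffWithinAt
    refine ⟨⟨fun e he => contDiffOn_smul_bilin ((hφ e he).pow 2) (hg.smooth e he),
        fun x u v => ?_, fun x u h => ?_⟩,
      fun e he => ((hφ e he).pow 2).smul (hT e he),
      ⟨fun e he => ((hφ e he).pow (p + 1)).smul (hk.smooth e he), fun e he y hy v w => ?_⟩⟩
    · exact congrArg (Ω x ^ 2 * ·) (hg.symm x u v)
    · exact hg.nondegenerate x u fun v =>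
        (mul_eq_zero.1 (h v)).resolve_left (pow_ne_zero 2 (hΩ0 x))
    · cases p with
      | zero => exact gckyOp_zero _ _ _ _ _ _
      | succ q =>
        have hG := differentiableAt_of_contDiffOn e.open_target hy (hg.smooth e he)
        have hK := differentiableAt_of_contDiffOn e.open_target hy (hk.smooth e he)
        have hd := differentiableAt_of_contDiffOn e.open_target hy (hφ e he)
        have hE : IsConformalKilling (localBilin e g y)
            (cov (localBilin e g) (localForm e T) (localForm e k) y) :=
          ⟨_, _, cov_eq_of_gckyOp_eq_zero _ (hk.equation e he y hy)⟩
        have h0 : Ω (e.symm y) ^ 2 ≠ 0 := pow_ne_zero 2 (hΩ0 _)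
        exact gckyOp_eq_zero_of_isConformalKilling
          (G := fun z => Ω (e.symm z) ^ 2 • localBilin e g z)
          (fun z => Ω (e.symm z) ^ 2 • localForm e T z)
          (K := fun z => Ω (e.symm z) ^ (q + 2) • localForm e k z)
          (fun u v => congrArg (Ω (e.symm y) ^ 2 * ·) (hs e he y hy u v))
          (fun u h => hn e he y hy u fun v => (mul_eq_zero.1 (h v)).resolve_left h0)
          (isConformalKilling_conformal (hn e he y hy) hG hd (hΩ0 _) hK hE) v w
  · have hV : ∀ e ∈ atlas (Model D) M, ContDiffOn ℝ ∞ (localVec e ξ) e.target := fun e he =>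
      contDiffOn_localVec he hξ
    have hLG' : ∀ e ∈ atlas (Model D) M, ∀ z ∈ e.target,
        lieBilin (localVec e ξ) (localBilin e g) z =
          (2 * f (e.symm z)) • localBilin e g z := by
      intro e he z hz
      rw [← localBilin_lieDerivBilin he hξ hg hz]
      ext u v
      rw [localBilin_apply, hLg]
      rfl
    have hLT' : ∀ e ∈ atlas (Model D) M, ∀ z ∈ e.target,
        lieForm (localVec e ξ) (localForm e T) z = (2 * f (e.symm z)) • localForm e T z := by
      intro e he z hz
      rw [← localForm_lieDerivForm he hξ hT hz, localForm, hLT]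
      rfl
    have hloc : ∀ e ∈ atlas (Model D) M, ∀ z ∈ e.target,
        localForm e (fun x => lieDerivForm ξ k x - (((p : ℝ) + 1) * f x) • k x) z =
          lieForm (localVec e ξ) (localForm e k) z -
            (((p : ℝ) + 1) * f (e.symm z)) • localForm e k z := by
      intro e he z hz
      rw [← localForm_lieDerivForm he hξ hk.smooth hz]
      rfl
    have hf : ∀ e ∈ atlas (Model D) M, ContDiffOn ℝ ∞ (fun z => f (e.symm z)) e.target :=
      fun e he => contDiffOn_conformalFactor e.open_target (hg.smooth e he) (hn e he) (hV e he)
        (hLG' e he)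
    refine ⟨fun e he => ?_, fun e he y hy v w => ?_⟩
    · exact ((contDiffOn_lieForm e.open_target (hV e he) (hk.smooth e he)).sub
        ((contDiffOn_const.mul (hf e he)).smul (hk.smooth e he))).congr (hloc e he)
    · cases p with
      | zero => exact gckyOp_zero _ _ _ _ _ _
      | succ q =>
        have h := gckyOp_lieForm e.open_target (hg.smooth e he) (hT e he) (hs e he) (hn e he)
          (hV e he) (hLG' e he) (hLT' e he) (hk.smooth e he) (hk.equation e he) hy v w
        rw [← h]
        -- The coordinate formula for the new form is known only on the chart target, but the
        -- operator depends only on the germ at `y`.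
        exact gckyOp_congr _ _ (Filter.eventuallyEq_of_mem (e.open_target.mem_nhds hy) (hloc e he))
          v w
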